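/- Let $S=\mathbb{C}[x,y,z]$. For a nonzero homogeneous polynomial $f\in S$ of degree $d\ge 1$ without multiple factors, let $J_f=(f_x,f_y,f_z)$ be its Jacobian ideal and $M(f)=S/J_f$ its Milnor algebra. The reduced curve $C: f=0$ in $\mathbb{P}^2_{\mathbb{C}}$ is called a 3-syzygy curve with exponents $(d_1,d_2,d_3)$, where $1\le d_1\le d_2\le d_3$, if $M(f)$ has a minimal graded free resolution of the form $$0\to S(-e)\to\bigoplus_{i=1}^{3}S(1-d-d_i)\to S^3(1-d)\xrightarrow{(f_x,f_y,f_z)}S\to M(f)\to 0 .$$ It is called plus-one generated with exponents $(d_1,d_2,d_3)$ if moreover $d_1+d_2=d$, and minimal plus-one generated if, in addition, $d_3=d_2+1$. A line arrangement has one of these properties if the product of the linear forms defining its lines has it. Let $\mathcal{K}\subset\mathbb{P}^2_{\mathbb{C}}$ be the Klein arrangement, that is, up to a projective change of coordinates, the arrangement of the 21 lines $ax+by+cz=0$ whose coefficient vectors $(a,b,c)$ are, up to scalars, the vectors obtained by permuting the coordinates of $(1,0,0)$, $(0,1,\pm1)$ and $(1,\pm1,\pm\alpha)$, where $\alpha=\frac{1+\sqrt{-7}}{2}$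 (these are the mirrors of the complex reflection group $G_{24}\cong \mathrm{PSL}(2,7)\times\{\pm1\}$). **Proposition.** For every line $\ell\in\mathcal{K}$, the arrangement $\mathcal{K}'=\mathcal{K}\setminus\{\ell\}$ of 20 lines is minimal plus-one generated with exponents $(9,11,12)$. -/

import Mathlib

noncomputable section

open MvPolynomial

namespace PlaneCurve

/-- The graded polynomial ring `S = ℂ[x, y, z]`. -/
abbrev S : Type := MvPolynomial (Fin 3) ℂ

/-- The gradient `(f_x, f_y, f_z)`. -/
def grad (f : S) : Fin 3 → S := fun i => pderiv i f

/-- The Jacobian ideal `J_f`. -/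
def jacobianIdeal (f : S) : Ideal S := Ideal.span (Set.range (grad f))

/-- The Milnor algebra `M(f) = S / J_f`. -/
abbrev MilnorAlgebra (f : S) : Type := S ⧸ jacobianIdeal f

/-- `f` defines a reduced plane curve of degree `d ≥ 1`. -/
structure IsReducedCurve (f : S) (d : ℕ) : Prop where
  pos : 1 ≤ d
  ne_zero : f ≠ 0
  homogeneous : f.IsHomogeneous d
  squarefree : Squarefree f

/-- Multiplication by `p` is a degree-preserving map `S(-b) → S(-a)`: `p` is homogeneous of degree
`b - a`, and `p = 0` if `b < a`. -/
def IsGradedEntry (p : S) (a b : ℕ) : Prop :=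
  p = 0 ∨ ∃ n : ℕ, a + n = b ∧ p.IsHomogeneous n

/-- `A` and `B` are the matrices of the two leftmost maps of a minimal graded free resolution
`0 → ⊕ⱼ S(-eⱼ) → ⊕ᵢ S(1 - d - δᵢ) → S³(1 - d) → S → M(f) → 0`,
where the map `S³(1 - d) → S` is given by the gradient of `f`, the index `i` runs through
`m = k + 2` values and `j` through `m - 2 = k` values. A graded free resolution is minimal when
no matrix entry has a nonzero constant term. -/
structure IsMinimalResolution (f : S) (d : ℕ) {k : ℕ} (δ : Fin (k + 2) → ℕ) (e : Fin k → ℕ)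
    (A : Matrix (Fin 3) (Fin (k + 2)) S) (B : Matrix (Fin (k + 2)) (Fin k) S) : Prop where
  graded_grad : ∀ i, IsGradedEntry (grad f i) 0 (d - 1)
  graded_A : ∀ i j, IsGradedEntry (A i j) (d - 1) (d - 1 + δ j)
  graded_B : ∀ i j, IsGradedEntry (B i j) (d - 1 + δ i) (e j)
  minimal_grad : ∀ i, constantCoeff (grad f i) = 0
  minimal_A : ∀ i j, constantCoeff (A i j) = 0
  minimal_B : ∀ i j, constantCoeff (B i j) = 0
  injective_B : Function.Injective B.mulVec
  exact_B_A : Function.Exact B.mulVec A.mulVec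
  exact_A_grad : Function.Exact A.mulVec (fun a : Fin 3 → S => a ⬝ᵥ grad f)
  exact_grad_mk : Function.Exact (fun a : Fin 3 → S => a ⬝ᵥ grad f)
    (Ideal.Quotient.mk (jacobianIdeal f))
  surjective_mk : Function.Surjective (Ideal.Quotient.mk (jacobianIdeal f))

/-- `f = 0` is a reduced curve of degree `d` that is an `m`-syzygy curve, `m = k + 2`, with
exponents `1 ≤ δ₁ ≤ ⋯ ≤ δₘ`. -/
def IsSyzygyCurve (f : S) (d : ℕ) {k : ℕ} (δ : Fin (k + 2) → ℕ) : Prop :=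
  IsReducedCurve f d ∧ Monotone δ ∧ (∀ i, 1 ≤ δ i) ∧
    ∃ (e : Fin k → ℕ) (A : Matrix (Fin 3) (Fin (k + 2)) S) (B : Matrix (Fin (k + 2)) (Fin k) S),
      Monotone e ∧ IsMinimalResolution f d δ e A B

/-- `f = 0` is a plus-one generated curve with exponents `(d₁, d₂, d₃)`. -/
def IsPlusOneGenerated (f : S) (d₁ d₂ d₃ : ℕ) : Prop :=
  ∃ d : ℕ, IsSyzygyCurve f d (k := 1) ![d₁, d₂, d₃] ∧ d₁ + d₂ = d

/-- `f = 0` is a minimal plus-one generated curve with exponents `(d₁, d₂, d₃)`. -/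
def IsMinimalPlusOneGenerated (f : S) (d₁ d₂ d₃ : ℕ) : Prop :=
  IsPlusOneGenerated f d₁ d₂ d₃ ∧ d₃ = d₂ + 1

end PlaneCurve

namespace LineArrangement

open PlaneCurve

/-- A line in `ℙ²(ℂ)`, given by its dual coordinates: the point `[a : b : c]` stands for the line
`a x + b y + c z = 0`. -/
abbrev Line : Type := Projectivization ℂ (Fin 3 → ℂ)

/-- The linear form `a x + b y + c z`. -/
def linearForm (v : Fin 3 → ℂ) : S := ∑ i, C (v i) * X i

/-- A defining polynomial of a line arrangement, the product of one linear form for each line;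
it is unique up to a nonzero constant factor. -/
def definingPolynomial (L : Finset Line) : S := ∏ ℓ ∈ L, linearForm ℓ.rep

open Classical in
/-- The arrangement `L ∖ {ℓ}`. -/
def deletion (L : Finset Line) (ℓ : Line) : Finset Line := L.erase ℓ

/-- `α = (1 + √-7) / 2`. -/
def alpha : ℂ := (1 + Complex.I * (Real.sqrt 7 : ℂ)) / 2

/-- Coefficients `(a, b, c)` of linear forms `a x + b y + c z` that define the 21 mirrors of Klein's
complex reflection group (number 24 in the list of Shephard and Todd, the product of `PSL(2, 7)` and
`{1, -1}`); up to scalars they are the vectors `(1, 0, 0)`, `(0, 1, ±1)`, `(1, ±1, ±α)` with their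
coordinates permuted. The 21 lines meet in 28 triple and 21 quadruple points. -/
def kleinNormal : Fin 21 → Fin 3 → ℂ :=
  ![![1, 0, 0], ![0, 1, 0], ![0, 0, 1],
    ![0, 1, 1], ![0, 1, -1], ![1, 0, 1], ![1, 0, -1], ![1, 1, 0], ![1, -1, 0],
    ![1, 1, alpha], ![1, 1, -alpha], ![1, -1, alpha], ![1, -1, -alpha],
    ![1, alpha, 1], ![1, -alpha, 1], ![1, alpha, -1], ![1, -alpha, -1],
    ![alpha, 1, 1], ![-alpha, 1, 1], ![alpha, 1, -1], ![-alpha, 1, -1]]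

theorem kleinNormal_ne_zero (i : Fin 21) : kleinNormal i ≠ 0 := by
  intro h
  have h0 := congrFun h 0
  have h1 := congrFun h 1
  have h2 := congrFun h 2
  fin_cases i <;> simp [kleinNormal] at h0 h1 h2

open Classical in
/-- The Klein arrangement of 21 lines in standard coordinates. -/
def standardKlein : Finset Line :=
  Finset.univ.image fun i => Projectivization.mk ℂ (kleinNormal i) (kleinNormal_ne_zero i)

open Classical in
/-- `K` is the Klein arrangement in some homogeneous coordinates of `ℙ²(ℂ)`. (A projective change of
coordinates acts on dual coordinates by an arbitrary invertible linear map.) -/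
def IsKlein (K : Finset Line) : Prop :=
  ∃ g : (Fin 3 → ℂ) ≃ₗ[ℂ] (Fin 3 → ℂ),
    K = standardKlein.image (Projectivization.map g.toLinearMap g.injective)

end LineArrangement

end

noncomputable section

open MvPolynomial PlaneCurve LineArrangement Matrix

namespace KleinDeletion

/-! The Klein arrangement is free with exponents (1, 9, 11). Besides the Euler field E, its
derivation module has the basis `theta₁`, `theta₂`, written out explicitly. Both are tangent to all
21 mirrors, and det(E, `theta₁`, `theta₂`) is a nonzero form of degree 1 + 9 + 11 = 21, so Saito's
criterion (`exists_mulVec_eq_of_tangent`) applies.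

Let f be the product of the 20 forms other than x. Syzygies of the gradient of f are the derivations
ψ that kill f. Subtracting multiples of E turns `theta₁`, `theta₂` into fields ρ₁, ρ₂ killing f. For
every such ψ the field xψ is tangent to all 21 lines, hence xψ = aρ₁ + bρ₂; the question is which
pairs (a, b) occur. On the line x = 0, modulo E, the fields ρ₁, ρ₂ become h₁ and h₂ times one common
field, with h₁ = y² + z² and h₂ = 2y²z² coprime. So (a, b) is, modulo x, a multiple of (h₂, -h₁).
This yields one new generator φ = (h₂ρ₁ - h₁ρ₂)/x, of degree 12, and one relation xφ = h₂ρ₁ - h₁ρ₂.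
`isSyzygyCurve_deletion` carries out this argument and `isSyzygyCurve_of_generators` assembles the
resolution.

Symmetries of the arrangement act transitively on the mirrors (`exists_permutes`), and resolutions
are transported along linear changes of coordinates (`isSyzygyCurve_lineSubst`), so the case of the
line x = 0 suffices. -/

theorem isHomogeneous_of_mul {p q : S} {m n : ℕ} (hp : p.IsHomogeneous m) (hp0 : p ≠ 0)
    (hpq : (p * q).IsHomogeneous (m + n)) : q.IsHomogeneous n := by
  classical
  have key : ∀ k, homogeneousComponent (m + k) (p * q) = p * homogeneousComponent k q := by
    intro k
    let := MvPolynomial.gradedAlgebra (σ := Fin 3) (R := ℂ)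
    have := DirectSum.coe_decompose_mul_add_of_left_mem (homogeneousSubmodule (Fin 3) ℂ)
      (i := m) (j := k) (a := p) (b := q) hp
    have e : ∀ (φ : S) (i : ℕ), (DirectSum.decompose (homogeneousSubmodule (Fin 3) ℂ) φ i : S) =
        homogeneousComponent i φ := fun φ i => decomposition.decompose'_apply φ i
    rwa [e, e] at this
  have h := key n
  rw [homogeneousComponent_eq_self hpq] at h
  rw [mul_left_cancel₀ hp0 h]
  exact homogeneousComponent_isHomogeneous n q

/-! ### Linear forms as primes of the polynomial ring -/

theorem linearForm_isHomogeneous (v : Fin 3 → ℂ) : (linearForm v).IsHomogeneous 1 :=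
  IsHomogeneous.sum _ _ _ fun _ _ => isHomogeneous_C_mul_X _ _

theorem linearForm_smul (c : ℂ) (v : Fin 3 → ℂ) : linearForm (c • v) = C c * linearForm v := by
  simp [linearForm, Finset.mul_sum, mul_assoc]

theorem coeff_linearForm (v : Fin 3 → ℂ) (i : Fin 3) :
    coeff (Finsupp.single i 1) (linearForm v) = v i := by
  classical
  simp [linearForm, coeff_sum, coeff_C_mul, coeff_X, Finsupp.single_left_inj]

theorem linearForm_ne_zero {v : Fin 3 → ℂ} (hv : v ≠ 0) : linearForm v ≠ 0 := by
  intro h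
  apply hv
  ext i
  rw [← coeff_linearForm v i, h]
  simp

theorem linearForm_prime {v : Fin 3 → ℂ} (hv : v ≠ 0) : Prime (linearForm v) := by
  rw [← UniqueFactorizationMonoid.irreducible_iff_prime]
  refine irreducible_of_totalDegree_eq_one
    ((linearForm_isHomogeneous v).totalDegree (linearForm_ne_zero hv)) fun x hx => ?_
  rw [isUnit_iff_ne_zero]
  rintro rfl
  apply linearForm_ne_zero hv
  ext d
  simpa using hx d

theorem exists_smul_of_linearForm_dvd {v w : Fin 3 → ℂ} (hv : v ≠ 0)
    (h : linearForm v ∣ linearForm w) : ∃ c : ℂ, c • v = w := by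
  obtain ⟨q, hq⟩ := h
  have hq0 : q.IsHomogeneous 0 := by
    refine isHomogeneous_of_mul (linearForm_isHomogeneous v) (linearForm_ne_zero hv) ?_
    rw [← hq]
    exact linearForm_isHomogeneous w
  rw [← totalDegree_zero_iff_isHomogeneous, totalDegree_eq_zero_iff_eq_C] at hq0
  refine ⟨coeff 0 q, ?_⟩
  ext i
  rw [← coeff_linearForm (_ • v), ← coeff_linearForm w, linearForm_smul, hq, mul_comm (linearForm v), ← hq0]

/-! ### Derivations and products of pairwise non-associated primes -/

/-- The derivation `v₀ ∂ₓ + v₁ ∂ᵧ + v₂ ∂_z`. -/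
def dir (v : Fin 3 → S) : Derivation ℂ S S := mkDerivation ℂ v

theorem dir_apply (v : Fin 3 → S) (f : S) : dir v f = v ⬝ᵥ grad f := by
  have : dir v = ∑ i, v i • (pderiv i : Derivation ℂ S S) := by
    apply derivation_ext
    intro i
    fin_cases i <;> simp [dir, Fin.sum_univ_three, pderiv_X, mkDerivation_X]
  rw [this]
  simp [Fin.sum_univ_three, dotProduct, grad]

theorem dir_linearForm (v : Fin 3 → S) (w : Fin 3 → ℂ) :
    dir v (linearForm w) = ∑ i, C (w i) * v i := by
  simp [dir, linearForm, mkDerivation_X, C_mul']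

theorem dir_add (v w : Fin 3 → S) (f : S) : dir (v + w) f = dir v f + dir w f := by
  simp [dir_apply]

theorem dir_sub (v w : Fin 3 → S) (f : S) : dir (v - w) f = dir v f - dir w f := by
  simp [dir_apply]

theorem dir_smul (a : S) (v : Fin 3 → S) (f : S) : dir (a • v) f = a * dir v f := by
  simp [dir_apply]

theorem derivation_mul (D : Derivation ℂ S S) (a b : S) : D (a * b) = a * D b + b * D a :=
  D.leibniz a b

theorem dvd_derivation_prod {ι : Type*} (D : Derivation ℂ S S) (s : Finset ι) (l : ι → S)
    (h : ∀ i ∈ s, l i ∣ D (l i)) : ∏ i ∈ s, l i ∣ D (∏ i ∈ s, l i) := by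
  classical
  induction s using Finset.induction_on with
  | empty => simp
  | insert a s ha ih =>
    rw [Finset.prod_insert ha, derivation_mul]
    refine dvd_add (mul_dvd_mul_left _ (ih fun i hi => h i (Finset.mem_insert_of_mem hi))) ?_
    rw [mul_comm]
    exact mul_dvd_mul_left _ (h a (Finset.mem_insert_self a s))

/-- In the Leibniz rule for l i times the cofactor, one term is a multiple of l i; the other
contains the cofactor, which is prime to l i. -/
theorem dvd_derivation_of_prod {ι : Type*} (D : Derivation ℂ S S) (s : Finset ι) (l : ι → S)
    (hp : ∀ i ∈ s, Prime (l i)) (hl : ∀ i ∈ s, ∀ j ∈ s, l i ∣ l j → i = j)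
    (h : ∏ i ∈ s, l i ∣ D (∏ i ∈ s, l i)) (i : ι) (hi : i ∈ s) : l i ∣ D (l i) := by
  classical
  have h1 := (Finset.dvd_prod_of_mem l hi).trans h
  rw [← Finset.mul_prod_erase s l hi, derivation_mul] at h1
  set r := ∏ j ∈ s.erase i, l j
  have h2 : l i ∣ r * D (l i) := (dvd_add_right (dvd_mul_right (l i) (D r))).1 h1
  refine ((hp i hi).dvd_or_dvd h2).resolve_left fun h3 => ?_
  obtain ⟨j, hj, hij⟩ := (hp i hi).exists_mem_finset_dvd h3
  rw [Finset.mem_erase] at hj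
  exact hj.1 (hl i hi j hj.2 hij).symm

theorem prod_dvd_of_primes {ι : Type*} (s : Finset ι) (l : ι → S) (hp : ∀ i ∈ s, Prime (l i))
    (hl : ∀ i ∈ s, ∀ j ∈ s, l i ∣ l j → i = j) (q : S) (h : ∀ i ∈ s, l i ∣ q) :
    ∏ i ∈ s, l i ∣ q := by
  refine Finset.prod_dvd_of_isRelPrime (fun i hi j hj hij => ?_) h
  exact ((hp i hi).irreducible.isRelPrime_iff_not_dvd).2 fun hd => hij (hl i hi j hj hd)

theorem squarefree_prod_of_primes {ι : Type*} (s : Finset ι) (l : ι → S)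
    (hp : ∀ i ∈ s, Prime (l i)) (hl : ∀ i ∈ s, ∀ j ∈ s, l i ∣ l j → i = j) :
    Squarefree (∏ i ∈ s, l i) := by
  classical
  induction s using Finset.induction_on with
  | empty => simp
  | insert a s ha ih =>
    rw [Finset.prod_insert ha, squarefree_mul_iff]
    refine ⟨?_, (hp a (Finset.mem_insert_self a s)).irreducible.squarefree, ih ?_ ?_⟩
    · refine ((hp a (Finset.mem_insert_self a s)).irreducible.isRelPrime_iff_not_dvd).2 fun hd => ?_
      obtain ⟨j, hj, hij⟩ := (hp a (Finset.mem_insert_self a s)).exists_mem_finset_dvd hd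
      have := hl a (Finset.mem_insert_self a s) j (Finset.mem_insert_of_mem hj) hij
      exact ha (this ▸ hj)
    · exact fun i hi => hp i (Finset.mem_insert_of_mem hi)
    · exact fun i hi j hj => hl i (Finset.mem_insert_of_mem hi) j (Finset.mem_insert_of_mem hj)

/-! ### Saito's criterion -/

theorem linearForm_dvd_det {w : Fin 3 → ℂ} (hw : w ≠ 0) (M : Matrix (Fin 3) (Fin 3) S)
    (h : ∀ k, linearForm w ∣ dir (fun r => M r k) (linearForm w)) : linearForm w ∣ M.det := by
  obtain ⟨i, hi⟩ := Function.ne_iff.1 hw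
  choose q hq using h
  have h1 : (fun i => C (w i)) ᵥ* M = linearForm w • q := by
    ext1 k
    simpa [dir_linearForm, vecMul, dotProduct] using hq k
  -- Multiplying by the adjugate turns divisibility of the row w M into divisibility of det M times
  -- w; some entry of w is a unit.
  have h2 : M.det • (fun i => (C (w i) : S)) = linearForm w • (q ᵥ* M.adjugate) := by
    rw [← smul_vecMul, ← h1, vecMul_vecMul, mul_adjugate, vecMul_smul, vecMul_one]
  have h3 : linearForm w ∣ M.det * C (w i) := ⟨_, congrFun h2 i⟩
  have hu : IsUnit (C (w i) : S) := (isUnit_iff_ne_zero.2 hi).map C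
  exact (hu.dvd_mul_right).1 h3

section Free

variable {ι : Type*} (s : Finset ι) (w : ι → Fin 3 → ℂ) (M : Matrix (Fin 3) (Fin 3) S)

theorem prod_linearForm_dvd_det (hw : ∀ i ∈ s, w i ≠ 0)
    (hl : ∀ i ∈ s, ∀ j ∈ s, linearForm (w i) ∣ linearForm (w j) → i = j)
    (h : ∀ i ∈ s, ∀ k, linearForm (w i) ∣ dir (fun r => M r k) (linearForm (w i))) :
    ∏ i ∈ s, linearForm (w i) ∣ M.det :=
  prod_dvd_of_primes s _ (fun i hi => linearForm_prime (hw i hi)) hl _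
    fun i hi => linearForm_dvd_det (hw i hi) M (h i hi)

/-- Saito's criterion: derivations tangent to the lines, with determinant a nonzero multiple of the
defining polynomial, generate all of them. -/
theorem exists_mulVec_eq_of_tangent (hw : ∀ i ∈ s, w i ≠ 0)
    (hl : ∀ i ∈ s, ∀ j ∈ s, linearForm (w i) ∣ linearForm (w j) → i = j)
    (h : ∀ i ∈ s, ∀ k, linearForm (w i) ∣ dir (fun r => M r k) (linearForm (w i)))
    (h0 : M.det ≠ 0) {d : ℕ} (hd : M.det.IsHomogeneous d) (hs : s.card = d)
    (ψ : Fin 3 → S) (hψ : ∀ i ∈ s, linearForm (w i) ∣ dir ψ (linearForm (w i))) :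
    ∃ u, ψ = M *ᵥ u := by
  obtain ⟨r, hr⟩ := prod_linearForm_dvd_det s w M hw hl h
  have hQ : (∏ i ∈ s, linearForm (w i)).IsHomogeneous d := by
    have := IsHomogeneous.prod s (fun i => linearForm (w i)) (fun _ => 1)
      fun i _ => linearForm_isHomogeneous (w i)
    simpa [hs] using this
  have hQ0 : ∏ i ∈ s, linearForm (w i) ≠ 0 :=
    Finset.prod_ne_zero_iff.2 fun i hi => linearForm_ne_zero (hw i hi)
  have hr0 : r.IsHomogeneous 0 := isHomogeneous_of_mul hQ hQ0 (by rwa [← hr])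
  rw [← totalDegree_zero_iff_isHomogeneous, totalDegree_eq_zero_iff_eq_C] at hr0
  have hc : coeff 0 r ≠ 0 := by
    intro hc
    rw [hc, map_zero] at hr0
    exact h0 (by rw [hr, hr0, mul_zero])
  have hu : IsUnit r := by
    rw [hr0]
    exact (isUnit_iff_ne_zero.2 hc).map C
  -- Replacing a column of M by ψ keeps all columns tangent, so each Cramer determinant is again
  -- divisible by the defining polynomial, which is det M up to a unit.
  have hdet : ∀ k, M.det ∣ cramer M ψ k := by
    intro k
    rw [hr, hu.mul_right_dvd, cramer_apply]
    refine prod_linearForm_dvd_det s w _ hw hl fun i hi j => ?_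
    by_cases hj : j = k
    · subst hj
      simpa using hψ i hi
    · simpa [updateCol_apply, hj] using h i hi j
  choose u hu using hdet
  refine ⟨u, ?_⟩
  have h1 : M *ᵥ (M.det • u) = M.det • ψ := by
    conv_rhs => rw [← mulVec_cramer]
    congr 1
    ext1 k
    exact (hu k).symm
  rw [mulVec_smul] at h1
  ext1 k
  exact mul_left_cancel₀ h0 (congrFun h1 k).symm

end Free

/-! ### The resolution after deleting a line -/

theorem isSyzygyCurve_of_generators {f : S} (hf : IsReducedCurve f 20) {ρ₁ ρ₂ φ : Fin 3 → S}
    {h₁ h₂ : S} (hρ₁ : ∀ i, (ρ₁ i).IsHomogeneous 9) (hρ₂ : ∀ i, (ρ₂ i).IsHomogeneous 11)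
    (hφ : ∀ i, (φ i).IsHomogeneous 12) (hh₁ : h₁.IsHomogeneous 2) (hh₂ : h₂.IsHomogeneous 4)
    (hrel : (X 0 : S) • φ = h₂ • ρ₁ - h₁ • ρ₂) (hdvd : ¬ (X 0 : S) ∣ h₁)
    (hρ₁f : dir ρ₁ f = 0) (hρ₂f : dir ρ₂ f = 0)
    (hind : ∀ a b : S, a • ρ₁ + b • ρ₂ = 0 → a = 0 ∧ b = 0)
    (hgen : ∀ ψ, dir ψ f = 0 → ∃ a b c : S, ψ = a • ρ₁ + b • ρ₂ + c • φ) :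
    IsSyzygyCurve f 20 (k := 1) ![9, 11, 12] := by
  have hx0 : (X 0 : S) ≠ 0 := X_ne_zero 0
  have hxp : Prime (X 0 : S) := X_prime
  have hφf : dir φ f = 0 := by
    have h := congrArg (fun v => dir v f) hrel
    simp only [dir_sub, dir_smul, hρ₁f, hρ₂f, mul_zero, sub_zero] at h
    exact (mul_eq_zero.1 h).resolve_left hx0
  have hgrad : ∀ i, (grad f i).IsHomogeneous 19 := fun i => hf.homogeneous.pderiv
  have hconst : ∀ (p : S) (n : ℕ), p.IsHomogeneous (n + 1) → constantCoeff p = 0 := by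
    intro p n hp
    rw [constantCoeff_eq]
    exact hp.coeff_eq_zero (by simp)
  let A : Matrix (Fin 3) (Fin 3) S := Matrix.of fun i j => ![ρ₁ i, ρ₂ i, φ i] j
  let B : Matrix (Fin 3) (Fin 1) S := Matrix.of fun i _ => ![h₂, -h₁, -X 0] i
  have hA : ∀ u, A *ᵥ u = u 0 • ρ₁ + u 1 • ρ₂ + u 2 • φ := by
    intro u
    ext1 i
    simp [A, mulVec, dotProduct, Fin.sum_univ_three, mul_comm]
  have hB : ∀ u, B *ᵥ u = u 0 • ![h₂, -h₁, -X 0] := by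
    intro u
    ext1 i
    simp [B, mulVec, dotProduct, mul_comm]
  have hX : (X 0 : S).IsHomogeneous 1 := isHomogeneous_X ℂ 0
  -- The relation has degree 32 = 19 + 9 + 4 = 19 + 11 + 2 = 19 + 12 + 1.
  refine ⟨hf, ?_, ?_, fun _ => 32, A, B, fun _ _ _ => le_rfl, ?_⟩
  · intro i j hij
    fin_cases i <;> fin_cases j <;> first | exact absurd hij (by decide) | simp
  · intro i
    fin_cases i <;> simp
  refine
    { graded_grad := fun i => Or.inr ⟨19, rfl, hgrad i⟩
      graded_A := ?_
      graded_B := ?_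
      minimal_grad := fun i => hconst _ 18 (hgrad i)
      minimal_A := ?_
      minimal_B := ?_
      injective_B := ?_
      exact_B_A := ?_
      exact_A_grad := ?_
      exact_grad_mk := ?_
      surjective_mk := Ideal.Quotient.mk_surjective }
  · intro i j
    fin_cases j
    · exact Or.inr ⟨9, rfl, hρ₁ i⟩
    · exact Or.inr ⟨11, rfl, hρ₂ i⟩
    · exact Or.inr ⟨12, rfl, hφ i⟩
  · intro i j
    fin_cases i
    · exact Or.inr ⟨4, rfl, hh₂⟩
    · exact Or.inr ⟨2, rfl, hh₁.neg⟩
    · exact Or.inr ⟨1, rfl, hX.neg⟩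
  · intro i j
    fin_cases j
    · exact hconst _ 8 (hρ₁ i)
    · exact hconst _ 10 (hρ₂ i)
    · exact hconst _ 11 (hφ i)
  · intro i j
    fin_cases i
    · exact hconst _ 3 hh₂
    · exact hconst _ 1 hh₁.neg
    · exact hconst _ 0 hX.neg
  · intro u v huv
    simp only [hB] at huv
    have h := congrFun huv 2
    simp only [Pi.smul_apply, smul_eq_mul] at h
    ext1 i
    fin_cases i
    exact mul_right_cancel₀ (neg_ne_zero.2 hx0) h
  · intro u
    constructor
    · intro hu
      rw [hA] at hu
      -- Multiplying the relation by x eliminates φ. Independence of ρ₁, ρ₂ then gives x ∣ u₂h₁, and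
      -- x is prime and does not divide h₁.
      have h1 : (X 0 * u 0 + u 2 * h₂) • ρ₁ + (X 0 * u 1 - u 2 * h₁) • ρ₂ = 0 := by
        have h2 : (X 0 : S) • (u 0 • ρ₁ + u 1 • ρ₂ + u 2 • φ) = 0 := by rw [hu, smul_zero]
        rw [smul_add, smul_comm _ (u 2), hrel] at h2
        rw [← h2]
        module
      obtain ⟨h2, h3⟩ := hind _ _ h1
      have h4 : (X 0 : S) ∣ u 2 * h₁ := ⟨u 1, by linear_combination -h3⟩
      obtain ⟨t, ht⟩ := (hxp.dvd_or_dvd h4).resolve_right hdvd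
      refine ⟨fun _ => -t, ?_⟩
      rw [hB]
      ext1 i
      fin_cases i
      · refine mul_left_cancel₀ hx0 ?_
        change X 0 * (-t * h₂) = X 0 * u 0
        linear_combination -h2 + h₂ * ht
      · refine mul_left_cancel₀ hx0 ?_
        change X 0 * (-t * -h₁) = X 0 * u 1
        linear_combination -h3 - h₁ * ht
      · simp [ht, mul_comm]
    · rintro ⟨t, rfl⟩
      rw [hA, hB]
      have : (t 0) • (h₂ • ρ₁ - h₁ • ρ₂ - (X 0 : S) • φ) = 0 := by rw [hrel, sub_self, smul_zero]
      rw [← this]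
      simp
      module
  · intro ψ
    change ψ ⬝ᵥ grad f = 0 ↔ _
    rw [← dir_apply]
    constructor
    · intro h
      obtain ⟨a, b, c, rfl⟩ := hgen ψ h
      exact ⟨![a, b, c], by rw [hA]; simp⟩
    · rintro ⟨u, rfl⟩
      rw [hA, dir_add, dir_add, dir_smul, dir_smul, dir_smul, hρ₁f, hρ₂f, hφf]
      simp
  · intro p
    rw [Ideal.Quotient.eq_zero_iff_mem, jacobianIdeal, Ideal.mem_span_range_iff_exists_fun]
    simp [dotProduct]

/-- The deletion of the line `x = 0` from a free arrangement of 21 lines with exponents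
`(1, 9, 11)` whose basis `θ₁, θ₂` restricts to that line, modulo the Euler derivation, as coprime
multiples `h₁, h₂` of one vector field. -/
theorem isSyzygyCurve_deletion (w : Fin 21 → Fin 3 → ℂ) (hw : ∀ i, w i ≠ 0)
    (hl : ∀ i j, linearForm (w i) ∣ linearForm (w j) → i = j) (hw0 : linearForm (w 0) = X 0)
    {θ₁ θ₂ : Fin 3 → S} (hθ₁ : ∀ i, (θ₁ i).IsHomogeneous 9) (hθ₂ : ∀ i, (θ₂ i).IsHomogeneous 11)
    (ht₁ : ∀ i, linearForm (w i) ∣ dir θ₁ (linearForm (w i)))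
    (ht₂ : ∀ i, linearForm (w i) ∣ dir θ₂ (linearForm (w i)))
    (hdet : (Matrix.of fun i j => ![X i, θ₁ i, θ₂ i] j : Matrix (Fin 3) (Fin 3) S).det ≠ 0)
    {P h₁ h₂ : S} (hh₁ : h₁.IsHomogeneous 2) (hh₂ : h₂.IsHomogeneous 4)
    (hP : ¬ X 0 ∣ P) (hxh : ¬ X 0 ∣ h₁)
    (hw₁ : X 0 ∣ X 2 * θ₁ 1 - X 1 * θ₁ 2 - P * h₁)
    (hw₂ : X 0 ∣ X 2 * θ₂ 1 - X 1 * θ₂ 2 - P * h₂)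
    (hcop : ∀ a b : S, X 0 ∣ a * h₁ + b * h₂ → ∃ t, X 0 ∣ a - t * h₂ ∧ X 0 ∣ b + t * h₁) :
    IsSyzygyCurve (∏ i ∈ Finset.univ.erase 0, linearForm (w i)) 20 (k := 1) ![9, 11, 12] := by
  have hx0 : (X 0 : S) ≠ 0 := X_ne_zero 0
  have hx : Prime (X 0 : S) := X_prime
  have hlp : ∀ i, Prime (linearForm (w i)) := fun i => linearForm_prime (hw i)
  set s : Finset (Fin 21) := Finset.univ.erase 0 with hs
  set f : S := ∏ i ∈ s, linearForm (w i) with hf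
  have hs_card : s.card = 20 := by simp [hs]
  have hfhom : f.IsHomogeneous 20 := by
    have := IsHomogeneous.prod s (fun i => linearForm (w i)) (fun _ => 1)
      fun i _ => linearForm_isHomogeneous (w i)
    simpa [hs_card] using this
  have hf0 : f ≠ 0 := Finset.prod_ne_zero_iff.2 fun i _ => (hlp i).ne_zero
  have hred : IsReducedCurve f 20 := ⟨by norm_num, hf0, hfhom,
    squarefree_prod_of_primes s _ (fun i _ => hlp i) fun i _ j _ => hl i j⟩
  have hxf : ¬ (X 0 : S) ∣ f := by
    intro h
    obtain ⟨j, hj, hij⟩ := hx.exists_mem_finset_dvd h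
    rw [← hw0] at hij
    exact (Finset.mem_erase.1 hj).1 (hl 0 j hij).symm
  have hE : dir X f = 20 * f := by
    have := hfhom.sum_X_mul_pderiv
    rw [dir_apply]
    simpa [dotProduct, grad] using this
  have htan : ∀ θ : Fin 3 → S, (∀ i, linearForm (w i) ∣ dir θ (linearForm (w i))) → f ∣ dir θ f :=
    fun θ h => dvd_derivation_prod (dir θ) s _ fun i _ => h i
  have proj : ∀ (θ : Fin 3 → S) (n : ℕ), (∀ i, (θ i).IsHomogeneous (n + 1)) →
      (∀ i, linearForm (w i) ∣ dir θ (linearForm (w i))) →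
      ∃ g : S, dir (θ - g • (X : Fin 3 → S)) f = 0 ∧ ∀ i, ((θ - g • (X : Fin 3 → S)) i).IsHomogeneous (n + 1) := by
    intro θ n hθ ht
    obtain ⟨g, hg⟩ := htan θ ht
    have hc : (20 : S) * C (1 / 20) = 1 := by
      rw [show (20 : S) = C 20 from rfl, ← C_mul]
      norm_num
    have hghom : g.IsHomogeneous n := by
      refine isHomogeneous_of_mul hfhom hf0 ?_
      rw [← hg, dir_apply]
      refine IsHomogeneous.sum _ _ _ fun i _ => ?_
      rw [show 20 + n = n + 1 + (20 - 1) by omega]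
      exact (hθ i).mul hfhom.pderiv
    -- Since E f = 20 f, subtracting (g/20)E cancels θ f = f g.
    refine ⟨C (1 / 20) * g, ?_, fun i => ?_⟩
    · rw [dir_sub, dir_smul, hE, hg]
      linear_combination (-(f * g)) * hc
    · exact (hθ i).sub ((hghom.C_mul _).mul (isHomogeneous_X ℂ i))
  obtain ⟨g₁, hρ₁f, hρ₁⟩ := proj θ₁ 8 hθ₁ ht₁
  obtain ⟨g₂, hρ₂f, hρ₂⟩ := proj θ₂ 10 hθ₂ ht₂
  set M : Matrix (Fin 3) (Fin 3) S := Matrix.of fun i j => ![X i, θ₁ i, θ₂ i] j with hM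
  have hMu : ∀ u, M *ᵥ u = u 0 • (X : Fin 3 → S) + u 1 • θ₁ + u 2 • θ₂ := by
    intro u
    ext1 i
    simp [hM, mulVec, dotProduct, Fin.sum_univ_three, mul_comm]
  set ρ₁ := θ₁ - g₁ • (X : Fin 3 → S) with hρ₁_def
  set ρ₂ := θ₂ - g₂ • (X : Fin 3 → S) with hρ₂_def
  have hind : ∀ a b : S, a • ρ₁ + b • ρ₂ = 0 → a = 0 ∧ b = 0 := by
    intro a b h
    have h1 : M *ᵥ ![-(a * g₁ + b * g₂), a, b] = 0 := by
      rw [hMu, ← h, hρ₁_def, hρ₂_def]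
      change -(a * g₁ + b * g₂) • (X : Fin 3 → S) + a • θ₁ + b • θ₂ = _
      module
    have h2 := eq_zero_of_mulVec_eq_zero hdet h1
    exact ⟨congrFun h2 1, congrFun h2 2⟩
  have hMhom : M.det.IsHomogeneous 21 := by
    rw [det_fin_three]
    have hX : ∀ i, (X i : S).IsHomogeneous 1 := isHomogeneous_X ℂ
    have h3 : ∀ i j k, (X i * θ₁ j * θ₂ k).IsHomogeneous 21 := fun i j k =>
      ((hX i).mul (hθ₁ j)).mul (hθ₂ k)
    have := ((((((h3 0 1 2).sub (h3 0 2 1)).sub (h3 1 0 2)).add (h3 2 0 1)).add (h3 1 2 0)).sub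
      (h3 2 1 0))
    change (X 0 * θ₁ 1 * θ₂ 2 - X 0 * θ₂ 1 * θ₁ 2 - θ₁ 0 * X 1 * θ₂ 2 + θ₁ 0 * θ₂ 1 * X 2 +
      θ₂ 0 * X 1 * θ₁ 2 - θ₂ 0 * θ₁ 1 * X 2 : S).IsHomogeneous 21
    refine (congrArg (fun p : S => p.IsHomogeneous 21) ?_).mp this
    ring
  have hspan : ∀ ψ : Fin 3 → S, dir ψ f = 0 → ∃ a b : S, (X 0 : S) • ψ = a • ρ₁ + b • ρ₂ := by
    -- The field xψ is tangent to x = 0 because of the factor x, and to the other lines because ψ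
    -- kills f.
    intro ψ hψ
    have hψt : ∀ i, linearForm (w i) ∣ dir ((X 0 : S) • ψ) (linearForm (w i)) := by
      intro i
      rw [dir_smul]
      by_cases hi : i = 0
      · rw [hi, hw0]
        exact dvd_mul_right _ _
      · refine Dvd.dvd.mul_left (dvd_derivation_of_prod (dir ψ) s _ (fun i _ => hlp i)
          (fun i _ j _ => hl i j) ?_ i (by simp [hs, hi])) _
        rw [← hf, hψ]
        exact dvd_zero _
    obtain ⟨u, hu⟩ := exists_mulVec_eq_of_tangent Finset.univ w M (fun i _ => hw i)
      (fun i _ j _ => hl i j) (fun i _ k => by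
        fin_cases k
        · change _ ∣ dir X _
          rw [dir_linearForm]
          exact dvd_refl _
        · exact ht₁ i
        · exact ht₂ i) hdet hMhom (by simp) _ (fun i _ => hψt i)
    rw [hMu] at hu
    have h1 : (X 0 : S) • ψ = (u 0 + u 1 * g₁ + u 2 * g₂) • (X : Fin 3 → S) + (u 1 • ρ₁ + u 2 • ρ₂) := by
      rw [hu, hρ₁_def, hρ₂_def]
      module
    -- On f only the Euler term survives, so its coefficient vanishes.
    have h2 := congrArg (fun v => dir v f) h1
    simp only [dir_add, dir_smul, hψ, hρ₁f, hρ₂f, hE, mul_zero, add_zero] at h2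
    have h3 : u 0 + u 1 * g₁ + u 2 * g₂ = 0 := by
      refine (mul_eq_zero.1 h2.symm).resolve_right (mul_ne_zero ?_ hf0)
      exact OfNat.ofNat_ne_zero 20
    exact ⟨u 1, u 2, by rw [h1, h3, zero_smul, zero_add]⟩
  have hwedge : ∀ a b : S, X 0 ∣ X 2 * (a • ρ₁ + b • ρ₂) 1 - X 1 * (a • ρ₁ + b • ρ₂) 2 -
      P * (a * h₁ + b * h₂) := by
    intro a b
    have := dvd_add (hw₁.mul_left a) (hw₂.mul_left b)
    convert this using 1
    simp [hρ₁_def, hρ₂_def]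
    ring
  -- On x = 0 this field is tangent to the line and has zero wedge with E, so it is proportional to
  -- E there. It kills f, whereas E f = 20 f is nonzero on the line; hence it vanishes modulo x.
  have hφ : ∀ i, (X 0 : S) ∣ (h₂ • ρ₁ - h₁ • ρ₂) i := by
    set v := h₂ • ρ₁ - h₁ • ρ₂ with hv
    have hv0 : (X 0 : S) ∣ v 0 := by
      have h1 := ht₁ 0
      have h2 := ht₂ 0
      simp only [hw0, dir, mkDerivation_X] at h1 h2
      have h3 : v 0 = h₂ * θ₁ 0 - h₁ * θ₂ 0 - X 0 * (h₂ * g₁ - h₁ * g₂) := by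
        simp [hv, hρ₁_def, hρ₂_def]
        ring
      rw [h3]
      exact dvd_sub (dvd_sub (h1.mul_left _) (h2.mul_left _)) (dvd_mul_right _ _)
    have hv12 : (X 0 : S) ∣ X 2 * v 1 - X 1 * v 2 := by
      have h1 := hwedge h₂ (-h₁)
      have h2 : P * (h₂ * h₁ + -h₁ * h₂) = 0 := by ring
      rwa [h2, sub_zero, neg_smul, ← sub_eq_add_neg] at h1
    have hvf : v 0 * grad f 0 + v 1 * grad f 1 + v 2 * grad f 2 = 0 := by
      have : dir v f = 0 := by rw [hv, dir_sub, dir_smul, dir_smul, hρ₁f, hρ₂f]; simp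
      rwa [dir_apply, dotProduct, Fin.sum_univ_three] at this
    rw [dir_apply, dotProduct, Fin.sum_univ_three] at hE
    have hcancel : ∀ q : S, (X 0 : S) ∣ q * (20 * f) → (X 0 : S) ∣ q := by
      intro q hq
      refine (hx.dvd_or_dvd hq).resolve_right fun h => ?_
      have hu : IsUnit (20 : S) := by
        rw [show (20 : S) = C 20 from rfl]
        exact (isUnit_iff_ne_zero.2 (by norm_num)).map C
      exact hxf (hu.dvd_mul_left.1 h)
    obtain ⟨a, ha⟩ := hv0
    obtain ⟨b, hb⟩ := hv12
    intro i
    fin_cases i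
    · exact ⟨a, ha⟩
    · refine hcancel _ ⟨v 1 * grad f 0 - X 1 * a * grad f 0 + b * grad f 2, ?_⟩
      simp only [Fin.mk_one]
      linear_combination (-v 1) * hE + X 1 * hvf - X 1 * grad f 0 * ha + grad f 2 * hb
    · refine hcancel _ ⟨v 2 * grad f 0 - X 2 * a * grad f 0 - b * grad f 1, ?_⟩
      simp only [Fin.reduceFinMk]
      linear_combination (-v 2) * hE + X 2 * hvf - X 2 * grad f 0 * ha - grad f 1 * hb
  choose φ hφ using hφ
  refine isSyzygyCurve_of_generators hred hρ₁ hρ₂ (φ := φ) (fun i => ?_) hh₁ hh₂ ?_ hxh hρ₁f hρ₂f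
    hind fun ψ hψ => ?_
  · refine isHomogeneous_of_mul (isHomogeneous_X ℂ 0) hx0 ?_
    rw [← hφ]
    exact (hh₂.mul (hρ₁ i)).sub (hh₁.mul (hρ₂ i))
  · ext1 i
    exact (hφ i).symm
  · obtain ⟨a, b, hab⟩ := hspan ψ hψ
    have h1 : X 0 ∣ a * h₁ + b * h₂ := by
      have h2 := hwedge a b
      rw [← hab] at h2
      have h3 : (X 0 : S) ∣ P * (a * h₁ + b * h₂) := by
        have h4 : (X 0 : S) ∣ X 2 * ((X 0 : S) • ψ) 1 - X 1 * ((X 0 : S) • ψ) 2 :=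
          ⟨X 2 * ψ 1 - X 1 * ψ 2, by simp; ring⟩
        simpa using dvd_sub h4 h2
      exact (hx.dvd_or_dvd h3).resolve_left hP
    -- With a = th₂ + xa' and b = -th₁ + xb', the field xψ equals x(a'ρ₁ + b'ρ₂ + tφ).
    obtain ⟨t, ⟨a', ha⟩, ⟨b', hb⟩⟩ := hcop a b h1
    refine ⟨a', b', t, ?_⟩
    ext1 i
    refine mul_left_cancel₀ hx0 ?_
    have h2 := congrFun hab i
    have h3 := hφ i
    simp only [Pi.add_apply, Pi.sub_apply, Pi.smul_apply, smul_eq_mul] at h2 h3 ⊢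
    linear_combination h2 + ρ₁ i * ha + ρ₂ i * hb + t * h3

/-! ### Coefficient polynomials and their divisibility identities -/

section Coefficients

variable {R : Type*} [CommRing R]

/-- The coefficient polynomial of an equivariant derivation of degree 9. -/
def coeff₁ (a u v w : R) : R :=
  u * ((a - 2) * u ^ 3 + 9 * u ^ 2 * (v + w) + (9 - 18 * a) * u * (v ^ 2 + w ^ 2) +
    (12 - 3 * a) * (v ^ 3 + w ^ 3) + (9 - 18 * a) * v * w * (v + w))

/-- The coefficient polynomial of an equivariant derivation of degree 11. -/
def coeff₂ (a u v w : R) : R :=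
  u * ((10 - 5 * a) * u ^ 3 * (v + w) + (1 - 2 * a) * u ^ 2 * (v ^ 2 + w ^ 2) +
    (3 - 6 * a) * u * (v ^ 3 + w ^ 3) + (11 - 22 * a) * u * v * w * (v + w) +
    (14 - 7 * a) * (v ^ 4 + w ^ 4) + (1 + 11 * a) * v * w * (v ^ 2 + w ^ 2))

theorem coeff₁_comm (a u v w : R) : coeff₁ a u v w = coeff₁ a u w v := by
  unfold coeff₁
  ring

theorem coeff₂_comm (a u v w : R) : coeff₂ a u v w = coeff₂ a u w v := by
  unfold coeff₂
  ring

/-- Tangency to the mirror x + y + az. The quotient is written with coefficients linear in a, so the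
identity holds only up to an explicit multiple of `ha`. -/
theorem dvd_coeff₁ {a : R} (ha : a ^ 2 = a - 2) (x y z : R) :
    x + y + a * z ∣ x * coeff₁ a (x ^ 2) (y ^ 2) (z ^ 2) + y * coeff₁ a (y ^ 2) (x ^ 2) (z ^ 2) +
      a * (z * coeff₁ a (z ^ 2) (x ^ 2) (y ^ 2)) := by
  unfold coeff₁
  refine ⟨
      (-2 + a) * x^8 + (2 - a) * x^7 * y + (2 + a) * x^7 * z + (7 + a) * x^6 * y^2 + (-4 - 2 * a) *
      x^6 * y * z + (11 - 3 * a) * x^6 * z^2 + (5 - 4 * a) * x^5 * y^3 + (6 - 6 * a) * x^5 * y^2 * z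
      + (-15 + 9 * a) * x^5 * y * z^2 + a * x^5 * z^3 + (4 - 14 * a) * x^4 * y^4 + (-14 + 5 * a) *
      x^4 * y^3 * z + (3 - 9 * a) * x^4 * y^2 * z^2 + (18 + 5 * a) * x^4 * y * z^3 + (11 - 19 * a) *
      x^4 * z^4 + (5 - 4 * a) * x^3 * y^5 + (-14 + 5 * a) * x^3 * y^4 * z + 16 * x^3 * y^3 * z^2 - 8
      * a * x^3 * y^2 * z^3 + (-1 - 4 * a) * x^3 * y * z^4 + (-2 - a) * x^3 * z^5 + (7 + a) * x^2 *
      y^6 + (6 - 6 * a) * x^2 * y^5 * z + (3 - 9 * a) * x^2 * y^4 * z^2 - 8 * a * x^2 * y^3 * z^3 +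
      (-6 - 6 * a) * x^2 * y^2 * z^4 + (-6 + 6 * a) * x^2 * y * z^5 + 10 * x^2 * z^6 + (2 - a) * x *
      y^7 + (-4 - 2 * a) * x * y^6 * z + (-15 + 9 * a) * x * y^5 * z^2 + (18 + 5 * a) * x * y^4 *
      z^3 + (-1 - 4 * a) * x * y^3 * z^4 + (-6 + 6 * a) * x * y^2 * z^5 + 2 * x * y * z^6 - a * x *
      z^7 + (-2 + a) * y^8 + (2 + a) * y^7 * z + (11 - 3 * a) * y^6 * z^2 + a * y^5 * z^3 + (11 - 19
      * a) * y^4 * z^4 + (-2 - a) * y^3 * z^5 + 10 * y^2 * z^6 - a * y * z^7 + (-2 + a) * z^8, ?_⟩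
  linear_combination (
      -x^8 * z + x^7 * y * z - x^7 * z^2 - x^6 * y^2 * z + 2 * x^6 * y * z^2 + 4 * x^5 * y^3 * z + 6
      * x^5 * y^2 * z^2 - 9 * x^5 * y * z^3 - x^5 * z^4 + 14 * x^4 * y^4 * z - 5 * x^4 * y^3 * z^2 -
      9 * x^4 * y^2 * z^3 - 5 * x^4 * y * z^4 + x^4 * z^5 + 4 * x^3 * y^5 * z - 5 * x^3 * y^4 * z^2
      + 8 * x^3 * y^2 * z^4 + 4 * x^3 * y * z^5 + x^3 * z^6 - x^2 * y^6 * z + 6 * x^2 * y^5 * z^2 -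
      9 * x^2 * y^4 * z^3 + 8 * x^2 * y^3 * z^4 + 6 * x^2 * y^2 * z^5 - 6 * x^2 * y * z^6 + x * y^7
      * z + 2 * x * y^6 * z^2 - 9 * x * y^5 * z^3 - 5 * x * y^4 * z^4 + 4 * x * y^3 * z^5 - 6 * x *
      y^2 * z^6 + x * z^8 - y^8 * z - y^7 * z^2 - y^5 * z^4 + y^4 * z^5 + y^3 * z^6 + y * z^8) * ha

/-- Tangency to the mirror y + z: for z = -y the squares of y and z agree and the two terms cancel.
-/
theorem add_dvd_coeff₁ (a x y z : R) :
    y + z ∣ y * coeff₁ a (y ^ 2) (x ^ 2) (z ^ 2) + z * coeff₁ a (z ^ 2) (x ^ 2) (y ^ 2) := by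
  unfold coeff₁
  refine ⟨
      (12 - 3 * a) * x^6 * y^2 + (-12 + 3 * a) * x^6 * y * z + (12 - 3 * a) * x^6 * z^2 + (9 - 18 *
      a) * x^4 * y^4 + (-9 + 18 * a) * x^4 * y^3 * z + (18 - 36 * a) * x^4 * y^2 * z^2 + (-9 + 18 *
      a) * x^4 * y * z^3 + (9 - 18 * a) * x^4 * z^4 + 9 * x^2 * y^6 - 9 * x^2 * y^5 * z + 9 * x^2 *
      y^4 * z^2 - 18 * a * x^2 * y^3 * z^3 + 9 * x^2 * y^2 * z^4 - 9 * x^2 * y * z^5 + 9 * x^2 * z^6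
      + (-2 + a) * y^8 + (2 - a) * y^7 * z + (7 + a) * y^6 * z^2 + (5 - 4 * a) * y^5 * z^3 + (4 - 14
      * a) * y^4 * z^4 + (5 - 4 * a) * y^3 * z^5 + (7 + a) * y^2 * z^6 + (2 - a) * y * z^7 + (-2 +
      a) * z^8, ?_⟩
  ring

theorem dvd_coeff₂ {a : R} (ha : a ^ 2 = a - 2) (x y z : R) :
    x + y + a * z ∣ x * coeff₂ a (x ^ 2) (y ^ 2) (z ^ 2) + y * coeff₂ a (y ^ 2) (x ^ 2) (z ^ 2) +
      a * (z * coeff₂ a (z ^ 2) (x ^ 2) (y ^ 2)) := by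
  unfold coeff₂
  refine ⟨
      (10 - 5 * a) * x^8 * y^2 + (10 - 5 * a) * x^8 * z^2 + (4 - 2 * a) * x^7 * y^3 + (-10 - 5 * a)
      * x^7 * y^2 * z + (-10 + 5 * a) * x^7 * y * z^2 + (4 + 2 * a) * x^7 * z^3 - 3 * x^6 * y^4 + (6
      + 3 * a) * x^6 * y^3 * z + 10 * a * x^6 * y^2 * z^2 + (6 + 3 * a) * x^6 * y * z^3 + (5 - 8 *
      a) * x^6 * z^4 + (6 - 6 * a) * x^5 * y^5 - 6 * x^5 * y^4 * z + (7 - 8 * a) * x^5 * y^3 * z^2 +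
      (-8 - a) * x^5 * y^2 * z^3 + (1 - a) * x^5 * y * z^4 - 4 * x^5 * z^5 - 3 * x^4 * y^6 - 6 * x^4
      * y^5 * z + (4 - 8 * a) * x^4 * y^4 * z^2 + (-8 + 2 * a) * x^4 * y^3 * z^3 + (8 - 12 * a) *
      x^4 * y^2 * z^4 + 2 * x^4 * y * z^5 + (3 - 2 * a) * x^4 * z^6 + (4 - 2 * a) * x^3 * y^7 + (6 +
      3 * a) * x^3 * y^6 * z + (7 - 8 * a) * x^3 * y^5 * z^2 + (-8 + 2 * a) * x^3 * y^4 * z^3 + (-4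
      + 18 * a) * x^3 * y^3 * z^4 + (18 - 7 * a) * x^3 * y^2 * z^5 - 3 * x^3 * y * z^6 - 2 * a * x^3
      * z^7 + (10 - 5 * a) * x^2 * y^8 + (-10 - 5 * a) * x^2 * y^7 * z + 10 * a * x^2 * y^6 * z^2 +
      (-8 - a) * x^2 * y^5 * z^3 + (8 - 12 * a) * x^2 * y^4 * z^4 + (18 - 7 * a) * x^2 * y^3 * z^5 -
      10 * x^2 * y^2 * z^6 + 5 * a * x^2 * y * z^7 + (10 - 5 * a) * x^2 * z^8 + (-10 + 5 * a) * x *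
      y^7 * z^2 + (6 + 3 * a) * x * y^6 * z^3 + (1 - a) * x * y^5 * z^4 + 2 * x * y^4 * z^5 - 3 * x
      * y^3 * z^6 + 5 * a * x * y^2 * z^7 + (10 - 5 * a) * y^8 * z^2 + (4 + 2 * a) * y^7 * z^3 + (5
      - 8 * a) * y^6 * z^4 - 4 * y^5 * z^5 + (3 - 2 * a) * y^4 * z^6 - 2 * a * y^3 * z^7 + (10 - 5 *
      a) * y^2 * z^8, ?_⟩
  linear_combination (
      5 * x^8 * y^2 * z - 2 * x^8 * z^3 + 2 * x^7 * y^3 * z + 5 * x^7 * y^2 * z^2 - 5 * x^7 * y *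
      z^3 - 2 * x^7 * z^4 - 3 * x^6 * y^3 * z^2 + x^6 * y^2 * z^3 - 3 * x^6 * y * z^4 + 2 * x^6 *
      z^5 + 6 * x^5 * y^5 * z + 8 * x^5 * y^3 * z^3 + x^5 * y^2 * z^4 + x^5 * y * z^5 + 8 * x^4 *
      y^4 * z^3 - 2 * x^4 * y^3 * z^4 - 10 * x^4 * y^2 * z^5 + 2 * x^3 * y^7 * z - 3 * x^3 * y^6 *
      z^2 + 8 * x^3 * y^5 * z^3 - 2 * x^3 * y^4 * z^4 - 18 * x^3 * y^3 * z^5 + 7 * x^3 * y^2 * z^6 +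
      2 * x^3 * z^8 + 5 * x^2 * y^8 * z + 5 * x^2 * y^7 * z^2 + x^2 * y^6 * z^3 + x^2 * y^5 * z^4 -
      10 * x^2 * y^4 * z^5 + 7 * x^2 * y^3 * z^6 - 5 * x^2 * y * z^8 - 5 * x * y^7 * z^3 - 3 * x *
      y^6 * z^4 + x * y^5 * z^5 - 5 * x * y^2 * z^8 - 2 * y^8 * z^3 - 2 * y^7 * z^4 + 2 * y^6 * z^5
      + 2 * y^3 * z^8) * ha

theorem add_dvd_coeff₂ (a x y z : R) :
    y + z ∣ y * coeff₂ a (y ^ 2) (x ^ 2) (z ^ 2) + z * coeff₂ a (z ^ 2) (x ^ 2) (y ^ 2) := by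
  unfold coeff₂
  refine ⟨
      (14 - 7 * a) * x^8 * y^2 + (-14 + 7 * a) * x^8 * y * z + (14 - 7 * a) * x^8 * z^2 + (3 - 6 *
      a) * x^6 * y^4 + (-3 + 6 * a) * x^6 * y^3 * z + (4 + 5 * a) * x^6 * y^2 * z^2 + (-3 + 6 * a) *
      x^6 * y * z^3 + (3 - 6 * a) * x^6 * z^4 + (1 - 2 * a) * x^4 * y^6 + (-1 + 2 * a) * x^4 * y^5 *
      z + (12 - 24 * a) * x^4 * y^4 * z^2 + (-12 + 24 * a) * x^4 * y^3 * z^3 + (12 - 24 * a) * x^4 *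
      y^2 * z^4 + (-1 + 2 * a) * x^4 * y * z^5 + (1 - 2 * a) * x^4 * z^6 + (10 - 5 * a) * x^2 * y^8
      + (-10 + 5 * a) * x^2 * y^7 * z + (10 - 5 * a) * x^2 * y^6 * z^2 + (-9 + 16 * a) * x^2 * y^5 *
      z^3 + (20 - 38 * a) * x^2 * y^4 * z^4 + (-9 + 16 * a) * x^2 * y^3 * z^5 + (10 - 5 * a) * x^2 *
      y^2 * z^6 + (-10 + 5 * a) * x^2 * y * z^7 + (10 - 5 * a) * x^2 * z^8 + (10 - 5 * a) * y^8 *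
      z^2 + (4 - 2 * a) * y^7 * z^3 - 3 * y^6 * z^4 + (6 - 6 * a) * y^5 * z^5 - 3 * y^4 * z^6 + (4 -
      2 * a) * y^3 * z^7 + (10 - 5 * a) * y^2 * z^8, ?_⟩
  ring

/-- With v = x² this computes the restriction of the field to x = 0. -/
theorem dvd_coeff₁_sub (a u v w : R) : v ∣ coeff₁ a u v w - coeff₁ a u 0 w := by
  unfold coeff₁
  refine ⟨u * (9 * u ^ 2 + (9 - 18 * a) * u * v + (12 - 3 * a) * v ^ 2 +
    (9 - 18 * a) * w * (v + w)), ?_⟩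
  ring

theorem dvd_coeff₂_sub (a u v w : R) : v ∣ coeff₂ a u v w - coeff₂ a u 0 w := by
  unfold coeff₂
  refine ⟨u * ((10 - 5 * a) * u ^ 3 + (1 - 2 * a) * u ^ 2 * v + (3 - 6 * a) * u * v ^ 2 +
    (11 - 22 * a) * u * w * (v + w) + (14 - 7 * a) * v ^ 3 +
    (1 + 11 * a) * w * (v ^ 2 + w ^ 2)), ?_⟩
  ring

end Coefficients

/-! ### The basic derivations of the Klein arrangement -/

theorem alpha_sq : alpha ^ 2 = alpha - 2 := by
  have h7 : ((Real.sqrt 7 : ℝ) : ℂ) ^ 2 = 7 := by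
    rw [← Complex.ofReal_pow, Real.sq_sqrt (by norm_num)]
    norm_num
  unfold alpha
  linear_combination (Complex.I ^ 2 / 4) * h7 + (7 / 4) * Complex.I_sq

theorem int_add_int_mul_alpha_eq_zero {u v : ℤ} (h : (u : ℂ) + v * alpha = 0) :
    u = 0 ∧ v = 0 := by
  have h7 : Real.sqrt 7 ≠ 0 := by positivity
  have him := congrArg Complex.im h
  have hv : v = 0 := by
    simpa [alpha, h7] using him
  subst hv
  simpa using h

/-- The derivation with coefficients `x p(x², y², z²)`, `y p(y², x², z²)`, `z p(z², x², y²)`. -/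
def oddField (p : S → S → S → S) : Fin 3 → S :=
  ![X 0 * p (X 0 ^ 2) (X 1 ^ 2) (X 2 ^ 2), X 1 * p (X 1 ^ 2) (X 0 ^ 2) (X 2 ^ 2),
    X 2 * p (X 2 ^ 2) (X 0 ^ 2) (X 1 ^ 2)]

theorem oddField_tangent (p : S → S → S → S) (hc : ∀ u v w, p u v w = p u w v)
    (h : ∀ x y z : S, x + y + C alpha * z ∣ x * p (x ^ 2) (y ^ 2) (z ^ 2) +
      y * p (y ^ 2) (x ^ 2) (z ^ 2) + C alpha * (z * p (z ^ 2) (x ^ 2) (y ^ 2)))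
    (h' : ∀ x y z : S, y + z ∣ y * p (y ^ 2) (x ^ 2) (z ^ 2) + z * p (z ^ 2) (x ^ 2) (y ^ 2))
    (i : Fin 21) : linearForm (kleinNormal i) ∣ dir (oddField p) (linearForm (kleinNormal i)) := by
  have c10 : ∀ u, p u (X 1 ^ 2) (X 0 ^ 2) = p u (X 0 ^ 2) (X 1 ^ 2) := fun u => hc _ _ _
  have c20 : ∀ u, p u (X 2 ^ 2) (X 0 ^ 2) = p u (X 0 ^ 2) (X 2 ^ 2) := fun u => hc _ _ _
  have c21 : ∀ u, p u (X 2 ^ 2) (X 1 ^ 2) = p u (X 1 ^ 2) (X 2 ^ 2) := fun u => hc _ _ _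
  rw [dir_linearForm, linearForm, Fin.sum_univ_three, Fin.sum_univ_three]
  have close : ∀ {a b c d : S}, a ∣ b → a = c → b = d → c ∣ d := by
    rintro a b _ _ hab rfl rfl
    exact hab
  fin_cases i
  · exact close (dvd_mul_right (X 0) (p (X 0 ^ 2) (X 1 ^ 2) (X 2 ^ 2)))
      (by simp [kleinNormal]) (by simp [kleinNormal, oddField])
  · exact close (dvd_mul_right (X 1) (p (X 1 ^ 2) (X 0 ^ 2) (X 2 ^ 2)))
      (by simp [kleinNormal]) (by simp [kleinNormal, oddField])
  · exact close (dvd_mul_right (X 2) (p (X 2 ^ 2) (X 0 ^ 2) (X 1 ^ 2)))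
      (by simp [kleinNormal]) (by simp [kleinNormal, oddField])
  -- Each remaining mirror arises from y + z or x + y + αz by permuting variables and changing
  -- signs. The field respects these operations, because p sees only squares and is symmetric in its
  -- last two arguments.
  on_goal 1 => have k := h' (X 0) (X 1) (X 2)
  on_goal 2 => have k := h' (X 0) (X 1) (-X 2)
  on_goal 3 => have k := h' (X 1) (X 0) (X 2)
  on_goal 4 => have k := h' (X 1) (X 0) (-X 2)
  on_goal 5 => have k := h' (X 2) (X 0) (X 1)
  on_goal 6 => have k := h' (X 2) (X 0) (-X 1)
  on_goal 7 => have k := h (X 0) (X 1) (X 2)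
  on_goal 8 => have k := h (X 0) (X 1) (-X 2)
  on_goal 9 => have k := h (X 0) (-X 1) (X 2)
  on_goal 10 => have k := h (X 0) (-X 1) (-X 2)
  on_goal 11 => have k := h (X 0) (X 2) (X 1)
  on_goal 12 => have k := h (X 0) (X 2) (-X 1)
  on_goal 13 => have k := h (X 0) (-X 2) (X 1)
  on_goal 14 => have k := h (X 0) (-X 2) (-X 1)
  on_goal 15 => have k := h (X 1) (X 2) (X 0)
  on_goal 16 => have k := h (X 1) (X 2) (-X 0)
  on_goal 17 => have k := h (X 1) (-X 2) (X 0)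
  on_goal 18 => have k := h (X 1) (-X 2) (-X 0)
  all_goals
    try simp only [neg_sq, c10, c20, c21] at k
    refine close k ?_ ?_ <;> simp [kleinNormal, oddField] <;> ring

/-- The basic derivation of degree 9 of the Klein arrangement. -/
def theta₁ : Fin 3 → S := oddField (coeff₁ (C alpha))

/-- The basic derivation of degree 11 of the Klein arrangement. -/
def theta₂ : Fin 3 → S := oddField (coeff₂ (C alpha))

theorem C_alpha_sq : (C alpha : S) ^ 2 = C alpha - 2 := by
  rw [← C_pow, alpha_sq, C_sub]
  rfl

theorem theta₁_tangent (i : Fin 21) :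
    linearForm (kleinNormal i) ∣ dir theta₁ (linearForm (kleinNormal i)) :=
  oddField_tangent _ (coeff₁_comm _) (dvd_coeff₁ C_alpha_sq) (add_dvd_coeff₁ _) i

theorem theta₂_tangent (i : Fin 21) :
    linearForm (kleinNormal i) ∣ dir theta₂ (linearForm (kleinNormal i)) :=
  oddField_tangent _ (coeff₂_comm _) (dvd_coeff₂ C_alpha_sq) (add_dvd_coeff₂ _) i

theorem isHomogeneous_C_mul_sq_monomial (i j k : Fin 3) (c : ℂ) (l m n : ℕ) :
    (C c * ((X i ^ 2) ^ l * (X j ^ 2) ^ m * (X k ^ 2) ^ n) : S).IsHomogeneous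
      (2 * l + 2 * m + 2 * n) := by
  have h : ∀ (i : Fin 3) (l : ℕ), ((X i ^ 2 : S) ^ l).IsHomogeneous (2 * l) := fun i l =>
    (isHomogeneous_X_pow i 2).pow l
  exact (((h i l).mul (h j m)).mul (h k n)).C_mul c

theorem isHomogeneous_coeff₁ (i j k : Fin 3) :
    (coeff₁ (C alpha) (X i ^ 2) (X j ^ 2) (X k ^ 2) : S).IsHomogeneous 8 := by
  have h := isHomogeneous_C_mul_sq_monomial i j k
  have H := (h (alpha - 2) 4 0 0).add <| (h 9 3 1 0).add <| (h 9 3 0 1).add <|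
    (h (9 - 18 * alpha) 2 2 0).add <| (h (9 - 18 * alpha) 2 0 2).add <|
    (h (12 - 3 * alpha) 1 3 0).add <| (h (12 - 3 * alpha) 1 0 3).add <|
    (h (9 - 18 * alpha) 1 2 1).add (h (9 - 18 * alpha) 1 1 2)
  refine (congrArg (fun q : S => q.IsHomogeneous 8) ?_).mp H
  simp only [coeff₁, map_sub, map_mul, map_ofNat]
  ring

theorem isHomogeneous_coeff₂ (i j k : Fin 3) :
    (coeff₂ (C alpha) (X i ^ 2) (X j ^ 2) (X k ^ 2) : S).IsHomogeneous 10 := by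
  have h := isHomogeneous_C_mul_sq_monomial i j k
  have H := (h (10 - 5 * alpha) 4 1 0).add <| (h (10 - 5 * alpha) 4 0 1).add <|
    (h (1 - 2 * alpha) 3 2 0).add <| (h (1 - 2 * alpha) 3 0 2).add <|
    (h (3 - 6 * alpha) 2 3 0).add <| (h (3 - 6 * alpha) 2 0 3).add <|
    (h (11 - 22 * alpha) 2 2 1).add <| (h (11 - 22 * alpha) 2 1 2).add <|
    (h (14 - 7 * alpha) 1 4 0).add <| (h (14 - 7 * alpha) 1 0 4).add <|
    (h (1 + 11 * alpha) 1 3 1).add (h (1 + 11 * alpha) 1 1 3)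
  refine (congrArg (fun q : S => q.IsHomogeneous 10) ?_).mp H
  simp only [coeff₂, map_sub, map_add, map_mul, map_ofNat, map_one]
  ring

theorem theta₁_isHomogeneous (i : Fin 3) : (theta₁ i).IsHomogeneous 9 := by
  have h : ∀ i j k l : Fin 3, (X i * coeff₁ (C alpha) (X j ^ 2) (X k ^ 2) (X l ^ 2) :
      S).IsHomogeneous (1 + 8) := fun i j k l =>
    (isHomogeneous_X ℂ i).mul (isHomogeneous_coeff₁ j k l)
  fin_cases i
  · exact h 0 0 1 2
  · exact h 1 1 0 2
  · exact h 2 2 0 1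

theorem theta₂_isHomogeneous (i : Fin 3) : (theta₂ i).IsHomogeneous 11 := by
  have h : ∀ i j k l : Fin 3, (X i * coeff₂ (C alpha) (X j ^ 2) (X k ^ 2) (X l ^ 2) :
      S).IsHomogeneous (1 + 10) := fun i j k l =>
    (isHomogeneous_X ℂ i).mul (isHomogeneous_coeff₂ j k l)
  fin_cases i
  · exact h 0 0 1 2
  · exact h 1 1 0 2
  · exact h 2 2 0 1

theorem det_theta_ne_zero :
    (Matrix.of fun i j => ![X i, theta₁ i, theta₂ i] j : Matrix (Fin 3) (Fin 3) S).det ≠ 0 := by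
  intro h
  have h1 := congrArg (eval (![1, 2, 3] : Fin 3 → ℂ)) h
  rw [det_fin_three] at h1
  simp [theta₁, theta₂, oddField, coeff₁, coeff₂] at h1
  -- The value of the determinant at (1, 2, 3) is quadratic in α; this is its reduction by α² = α -
  -- 2.
  have h2 : ((-23758479360 : ℤ) : ℂ) + (-22736609280 : ℤ) * alpha = 0 := by
    push_cast
    linear_combination h1 - 21535580160 * alpha_sq
  exact absurd (int_add_int_mul_alpha_eq_zero h2).1 (by norm_num)

/-! ### Restriction to the line x = 0 -/

theorem X_dvd_sub_aeval (q : S) : X 0 ∣ q - aeval (![0, X 1, X 2] : Fin 3 → S) q := by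
  rw [← Ideal.mem_span_singleton, ← Ideal.Quotient.mk_eq_mk_iff_sub_mem]
  have : (Ideal.Quotient.mkₐ ℂ (Ideal.span {(X 0 : S)})) =
      (Ideal.Quotient.mkₐ ℂ (Ideal.span {(X 0 : S)})).comp
        (aeval (![0, X 1, X 2] : Fin 3 → S)) := by
    ext i
    fin_cases i
    · simp
    · simp
    · simp
  exact DFunLike.congr_fun this q

theorem isRelPrime_restrictions : IsRelPrime (X 1 ^ 2 + X 2 ^ 2 : S) (2 * (X 1 ^ 2 * X 2 ^ 2)) := by
  have h : ∀ (i j : Fin 3), i ≠ j → ∀ q : S, q = X i ^ 2 + X j ^ 2 → IsRelPrime (X i ^ 2) q := by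
    rintro i j hij q rfl
    refine IsRelPrime.pow_left (((X_prime (i := i)).irreducible.isRelPrime_iff_not_dvd).2 ?_)
    rintro ⟨r, hr⟩
    -- At the j-th unit vector X i vanishes, while the sum of squares is 1.
    have := congrArg (eval (Pi.single j 1 : Fin 3 → ℂ)) hr
    simp [hij] at this
  have hu : IsUnit (2 : S) := by
    rw [show (2 : S) = C 2 from rfl]
    exact (isUnit_iff_ne_zero.2 two_ne_zero).map C
  refine IsRelPrime.symm (IsRelPrime.mul_left hu.isRelPrime_left (IsRelPrime.mul_left ?_ ?_))
  · exact h 1 2 (by decide) _ rfl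
  · exact h 2 1 (by decide) _ (add_comm _ _)

/-- Setting x = 0 makes the congruence an equation between polynomials in y and z, where coprimality
leaves only the Koszul syzygy. -/
theorem restrictions_coprime (a b : S)
    (h : X 0 ∣ a * (X 1 ^ 2 + X 2 ^ 2) + b * (2 * (X 1 ^ 2 * X 2 ^ 2))) :
    ∃ t, X 0 ∣ a - t * (2 * (X 1 ^ 2 * X 2 ^ 2)) ∧ X 0 ∣ b + t * (X 1 ^ 2 + X 2 ^ 2) := by
  set π : S →ₐ[ℂ] S := aeval (![0, X 1, X 2] : Fin 3 → S)
  have hπ : π a * (X 1 ^ 2 + X 2 ^ 2) + π b * (2 * (X 1 ^ 2 * X 2 ^ 2)) = 0 := by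
    obtain ⟨q, hq⟩ := h
    have := congrArg π hq
    simp only [map_add, map_mul, map_pow, map_ofNat, π, aeval_X] at this
    simpa [π] using this
  have h1 : (X 1 ^ 2 + X 2 ^ 2 : S) ∣ π b * (2 * (X 1 ^ 2 * X 2 ^ 2)) :=
    ⟨-π a, by linear_combination hπ⟩
  obtain ⟨t, ht⟩ := isRelPrime_restrictions.dvd_of_dvd_mul_right h1
  have h0 : (X 1 ^ 2 + X 2 ^ 2 : S) ≠ 0 := by
    intro h0
    have := congrArg (eval (Pi.single 1 1 : Fin 3 → ℂ)) h0
    simp at this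
  have ha : π a = -t * (2 * (X 1 ^ 2 * X 2 ^ 2)) := by
    refine mul_left_cancel₀ h0 ?_
    linear_combination hπ - 2 * (X 1 ^ 2 * X 2 ^ 2) * ht
  refine ⟨-t, ?_, ?_⟩
  · rw [← ha]
    exact X_dvd_sub_aeval a
  · have : b + -t * (X 1 ^ 2 + X 2 ^ 2) = b - π b := by
      rw [ht]
      ring
    rw [this]
    exact X_dvd_sub_aeval b

/-! ### Exact computation with the mirrors over ℤ[α] -/

/-- The ring `ℤ[α]`, where `α² = α - 2`. -/
abbrev KleinInt : Type := QuadraticAlgebra ℤ (-2) 1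

/-- The embedding of `ℤ[α]` into `ℂ`. -/
def toComplex : KleinInt →+* ℂ where
  toFun z := z.re + z.im * alpha
  map_zero' := by simp
  map_one' := by simp [QuadraticAlgebra.re_one, QuadraticAlgebra.im_one]
  map_add' z w := by
    simp
    ring
  map_mul' z w := by
    simp
    linear_combination (-(z.im : ℂ) * w.im) * alpha_sq

theorem toComplex_injective : Function.Injective toComplex := by
  rw [injective_iff_map_eq_zero]
  intro z hz
  have := int_add_int_mul_alpha_eq_zero hz
  exact QuadraticAlgebra.ext this.1 this.2

/-- The vectors `kleinNormal` over `ℤ[α]`. -/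
def intNormal : Fin 21 → Fin 3 → KleinInt :=
  ![![1, 0, 0], ![0, 1, 0], ![0, 0, 1],
    ![0, 1, 1], ![0, 1, -1], ![1, 0, 1], ![1, 0, -1], ![1, 1, 0], ![1, -1, 0],
    ![1, 1, ⟨0, 1⟩], ![1, 1, -⟨0, 1⟩], ![1, -1, ⟨0, 1⟩], ![1, -1, -⟨0, 1⟩],
    ![1, ⟨0, 1⟩, 1], ![1, -⟨0, 1⟩, 1], ![1, ⟨0, 1⟩, -1], ![1, -⟨0, 1⟩, -1],
    ![⟨0, 1⟩, 1, 1], ![-⟨0, 1⟩, 1, 1], ![⟨0, 1⟩, 1, -1], ![-⟨0, 1⟩, 1, -1]]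

theorem toComplex_alpha : toComplex ⟨0, 1⟩ = alpha := by
  simp [toComplex]

theorem toComplex_neg_alpha : toComplex ⟨0, -1⟩ = -alpha := by
  simp [toComplex]

theorem kleinNormal_eq (i : Fin 21) : kleinNormal i = toComplex ∘ intNormal i := by
  ext j
  fin_cases i <;> fin_cases j <;> simp [kleinNormal, intNormal, toComplex_alpha, toComplex_neg_alpha]

/-- The cross product of two vectors over `ℤ[α]`. -/
def intCross (v w : Fin 3 → KleinInt) : Fin 3 → KleinInt :=
  ![v 1 * w 2 - v 2 * w 1, v 2 * w 0 - v 0 * w 2, v 0 * w 1 - v 1 * w 0]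

theorem intCross_ne_zero : ∀ i j : Fin 21, i ≠ j → intCross (intNormal i) (intNormal j) ≠ 0 := by
  decide +kernel

/-! ### Invariance under linear changes of coordinates -/

section Substitution

variable (g : (Fin 3 → ℂ) ≃ₗ[ℂ] (Fin 3 → ℂ))

/-- The substitution that sends the linear form of `v` to the linear form of `g v`. -/
def substHom (g : (Fin 3 → ℂ) ≃ₗ[ℂ] (Fin 3 → ℂ)) : S →ₐ[ℂ] S :=
  aeval fun i => linearForm (g (Pi.single i 1))

theorem linearForm_add (v w : Fin 3 → ℂ) : linearForm (v + w) = linearForm v + linearForm w := by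
  simp [linearForm, add_mul, Finset.sum_add_distrib]

theorem substHom_linearForm (v : Fin 3 → ℂ) : substHom g (linearForm v) = linearForm (g v) := by
  have hv : g v = v 0 • g (Pi.single 0 1) + v 1 • g (Pi.single 1 1) + v 2 • g (Pi.single 2 1) := by
    rw [← map_smul, ← map_smul, ← map_smul, ← map_add, ← map_add]
    congr 1
    ext i
    fin_cases i <;> simp
  rw [hv, linearForm_add, linearForm_add, linearForm_smul, linearForm_smul, linearForm_smul]
  simp [linearForm, Fin.sum_univ_three, substHom, algebraMap_eq]

theorem substHom_substHom_symm (g : (Fin 3 → ℂ) ≃ₗ[ℂ] (Fin 3 → ℂ)) :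
    (substHom g).comp (substHom g.symm) = AlgHom.id ℂ S := by
  ext1 i
  have : substHom g.symm (X i) = linearForm (g.symm (Pi.single i 1)) := by simp [substHom]
  rw [AlgHom.comp_apply, this, substHom_linearForm, g.apply_symm_apply]
  simp [linearForm, Pi.single_apply]

/-- The substitution `substHom` as an automorphism. -/
def lineSubst : S ≃ₐ[ℂ] S :=
  AlgEquiv.ofAlgHom (substHom g) (substHom g.symm) (substHom_substHom_symm g)
    (substHom_substHom_symm g.symm)

theorem lineSubst_linearForm (v : Fin 3 → ℂ) : lineSubst g (linearForm v) = linearForm (g v) :=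
  substHom_linearForm g v

theorem lineSubst_C (c : ℂ) : lineSubst g (C c) = C c := (lineSubst g).commutes c

theorem lineSubst_X (i : Fin 3) : lineSubst g (X i) = linearForm (g (Pi.single i 1)) := by
  change substHom g (X i) = _
  simp [substHom]

theorem lineSubst_isHomogeneous {p : S} {n : ℕ} (hp : p.IsHomogeneous n) :
    (lineSubst g p).IsHomogeneous n := by
  have := hp.aeval (fun i => linearForm (g (Pi.single i 1))) fun i => linearForm_isHomogeneous _
  rwa [one_mul] at this

theorem constantCoeff_linearForm (v : Fin 3 → ℂ) : constantCoeff (linearForm v) = 0 := by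
  simp [linearForm]

theorem constantCoeff_lineSubst (p : S) : constantCoeff (lineSubst g p) = constantCoeff p := by
  induction p using MvPolynomial.induction_on with
  | C a => rw [lineSubst_C]
  | add p q hp hq => rw [map_add, map_add, map_add, hp, hq]
  | mul_X p i hp => simp [lineSubst_X, constantCoeff_linearForm]

/-- The Jacobian matrix of `lineSubst g`. -/
def jacobian : Matrix (Fin 3) (Fin 3) S := Matrix.of fun i j => C (g (Pi.single j 1) i)

theorem pderiv_linearForm (v : Fin 3 → ℂ) (i : Fin 3) : pderiv i (linearForm v) = C (v i) := by
  fin_cases i <;> simp [linearForm, Fin.sum_univ_three, pderiv_X]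

/-- The chain rule; the Jacobian matrix is constant because the substitution is linear. -/
theorem grad_lineSubst (f : S) : grad (lineSubst g f) = jacobian g *ᵥ (lineSubst g ∘ grad f) := by
  ext1 i
  change pderiv i (lineSubst g f) = ∑ j, C (g (Pi.single j 1) i) * lineSubst g (pderiv j f)
  induction f using MvPolynomial.induction_on with
  | C a => simp [lineSubst_C]
  | add p q hp hq => simp only [map_add, hp, hq, mul_add, Finset.sum_add_distrib]
  | mul_X p k hp =>
    rw [map_mul, pderiv_mul, hp, lineSubst_X, pderiv_linearForm]
    simp only [pderiv_mul, pderiv_X, map_add, map_mul, lineSubst_X, mul_add, Finset.sum_add_distrib,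
      Finset.sum_mul]
    congr 1
    · exact Finset.sum_congr rfl fun j _ => by ring
    · rw [Finset.sum_eq_single k]
      · simp [mul_comm]
      · intro j _ hj
        simp [hj.symm]
      · simp

theorem jacobian_mul_symm (g : (Fin 3 → ℂ) ≃ₗ[ℂ] (Fin 3 → ℂ)) :
    jacobian g * jacobian g.symm = 1 := by
  ext1 i j
  have h1 : g (g.symm (Pi.single j 1)) i = (Pi.single j 1 : Fin 3 → ℂ) i := by
    rw [g.apply_symm_apply]
  have hv : ∀ v : Fin 3 → ℂ, g v i = ∑ k, g (Pi.single k 1) i * v k := by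
    intro v
    have : v = ∑ k, v k • (Pi.single k 1 : Fin 3 → ℂ) := by
      ext l
      simp [Finset.sum_apply, Pi.single_apply]
    conv_lhs => rw [this]
    simp [map_sum, Finset.sum_apply, mul_comm]
  rw [hv] at h1
  have h2 := congrArg (C : ℂ → S) h1
  rw [map_sum] at h2
  simp only [mul_apply, jacobian, of_apply]
  simp only [C_mul] at h2
  rw [h2, one_apply, Pi.single_apply]
  split_ifs <;> simp

theorem squarefree_lineSubst {f : S} (hf : Squarefree f) : Squarefree (lineSubst g f) := by
  intro a ha
  have h := hf ((lineSubst g).symm a) (by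
    have := map_dvd (lineSubst g).symm ha
    simpa using this)
  have h' := h.map (lineSubst g)
  rwa [AlgEquiv.apply_symm_apply] at h'

theorem isReducedCurve_lineSubst {f : S} {d : ℕ} (hf : IsReducedCurve f d) {c : ℂ} (hc : c ≠ 0) :
    IsReducedCurve (C c * lineSubst g f) d := by
  have hu : IsUnit (C c : S) := (isUnit_iff_ne_zero.2 hc).map C
  refine ⟨hf.pos, mul_ne_zero hu.ne_zero ?_, ?_, ?_⟩
  · exact (map_ne_zero_iff _ (lineSubst g).injective).2 hf.ne_zero
  · exact (lineSubst_isHomogeneous g hf.homogeneous).C_mul c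
  · exact (associated_unit_mul_left _ _ hu).symm.squarefree_iff.1 (squarefree_lineSubst g hf.squarefree)

theorem isGradedEntry_lineSubst {p : S} {a b : ℕ} (hp : IsGradedEntry p a b) :
    IsGradedEntry (lineSubst g p) a b := by
  rcases hp with rfl | ⟨n, hn, hp⟩
  · exact Or.inl (map_zero _)
  · exact Or.inr ⟨n, hn, lineSubst_isHomogeneous g hp⟩

theorem isGradedEntry_sum_C_mul {p : Fin 3 → S} {a b : ℕ} (hp : ∀ i, IsGradedEntry (p i) a b)
    (r : Fin 3 → ℂ) : IsGradedEntry (∑ i, C (r i) * p i) a b := by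
  by_cases hab : a ≤ b
  · refine Or.inr ⟨b - a, by omega, IsHomogeneous.sum _ _ _ fun i _ => ?_⟩
    rcases hp i with h | ⟨n, hn, h⟩
    · rw [h, mul_zero]
      exact isHomogeneous_zero _ _ _
    · obtain rfl : n = b - a := by omega
      exact h.C_mul _
  · refine Or.inl (Finset.sum_eq_zero fun i _ => ?_)
    rcases hp i with h | ⟨n, hn, _⟩
    · rw [h, mul_zero]
    · omega

theorem comp_mulVec (T : S ≃ₐ[ℂ] S) {m n : ℕ} (A : Matrix (Fin m) (Fin n) S) (u : Fin n → S) :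
    T ∘ (A *ᵥ u) = A.map T *ᵥ (T ∘ u) := by
  ext1 i
  simp [mulVec, dotProduct, map_sum]

theorem exists_eq_comp (T : S ≃ₐ[ℂ] S) {n : ℕ} (v : Fin n → S) : ∃ u, v = T ∘ u :=
  ⟨T.symm ∘ v, by ext1 i; simp⟩

theorem comp_injective (T : S ≃ₐ[ℂ] S) {n : ℕ} {u v : Fin n → S} (h : T ∘ u = T ∘ v) : u = v :=
  T.injective.comp_left h

-- By the chain rule, pairing a with the new gradient is, up to the unit c, pairing Nᵀa with the
-- substituted old one, N being the Jacobian matrix. So the new syzygies are the substituted old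
-- ones multiplied by the inverse of Nᵀ, while the relations among them are merely substituted.
set_option maxHeartbeats 1000000 in
theorem isMinimalResolution_lineSubst {f : S} {d k : ℕ} {δ : Fin (k + 2) → ℕ} {e : Fin k → ℕ}
    {A : Matrix (Fin 3) (Fin (k + 2)) S} {B : Matrix (Fin (k + 2)) (Fin k) S}
    (h : IsMinimalResolution f d δ e A B) {c : ℂ} (hc : c ≠ 0) :
    IsMinimalResolution (C c * lineSubst g f) d δ e ((jacobian g.symm)ᵀ * A.map (lineSubst g))
      (B.map (lineSubst g)) := by
  set T := lineSubst g with hT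
  set N := jacobian g with hN
  set N' := jacobian g.symm with hN'
  have hNN : N * N' = 1 := jacobian_mul_symm g
  have hNN' : N'ᵀ * Nᵀ = 1 := by rw [← transpose_mul, hNN, transpose_one]
  have hNN'' : Nᵀ * N'ᵀ = 1 := mul_eq_one_comm.1 hNN'
  have hC : (C c : S) ≠ 0 := by simpa using hc
  have hgrad : ∀ a : Fin 3 → S, a ⬝ᵥ grad (C c * T f) = C c * ((Nᵀ *ᵥ a) ⬝ᵥ (T ∘ grad f)) := by
    intro a
    have h1 : grad (C c * T f) = (C c : S) • grad (T f) := by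
      ext1 i
      simp [grad]
    rw [h1, dotProduct_smul, hT, grad_lineSubst, dotProduct_mulVec, ← mulVec_transpose]
    rfl
  have hdot : ∀ a b : Fin 3 → S, T (a ⬝ᵥ b) = (T ∘ a) ⬝ᵥ (T ∘ b) := by
    intro a b
    simp [dotProduct, map_sum]
  have hA : ∀ u, (N'ᵀ * A.map T) *ᵥ (T ∘ u) = N'ᵀ *ᵥ (T ∘ (A *ᵥ u)) := by
    intro u
    rw [comp_mulVec, mulVec_mulVec]
  have hgrad_i : ∀ i, grad (C c * T f) i = ∑ j, C (c * g (Pi.single j 1) i) * T (grad f j) := by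
    intro i
    have h1 : grad (C c * T f) i = C c * grad (T f) i := by simp [grad]
    rw [h1, hT, grad_lineSubst]
    simp [mulVec, dotProduct, jacobian, Finset.mul_sum, mul_assoc]
  have hA_i : ∀ i j, (N'ᵀ * A.map T) i j = ∑ l, C (g.symm (Pi.single i 1) l) * T (A l j) := by
    intro i j
    simp [mul_apply, hN', jacobian]
  refine
    { graded_grad := fun i => ?_
      graded_A := fun i j => ?_
      graded_B := fun i j => isGradedEntry_lineSubst g (h.graded_B i j)
      minimal_grad := fun i => ?_
      minimal_A := fun i j => ?_
      minimal_B := fun i j => (constantCoeff_lineSubst g _).trans (h.minimal_B i j)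
      injective_B := ?_
      exact_B_A := ?_
      exact_A_grad := ?_
      exact_grad_mk := ?_
      surjective_mk := Ideal.Quotient.mk_surjective }
  · rw [hgrad_i]
    exact isGradedEntry_sum_C_mul (fun j => isGradedEntry_lineSubst g (h.graded_grad j)) _
  · rw [hA_i]
    exact isGradedEntry_sum_C_mul (fun l => isGradedEntry_lineSubst g (h.graded_A l j)) _
  · rw [hgrad_i, map_sum]
    refine Finset.sum_eq_zero fun j _ => ?_
    rw [map_mul, hT, constantCoeff_lineSubst, h.minimal_grad, mul_zero]
  · rw [hA_i, map_sum]
    refine Finset.sum_eq_zero fun l _ => ?_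
    rw [map_mul, hT, constantCoeff_lineSubst, h.minimal_A, mul_zero]
  · intro u v huv
    obtain ⟨u, rfl⟩ := exists_eq_comp T u
    obtain ⟨v, rfl⟩ := exists_eq_comp T v
    rw [← comp_mulVec, ← comp_mulVec] at huv
    rw [h.injective_B (comp_injective T huv)]
  · intro u
    obtain ⟨u, rfl⟩ := exists_eq_comp T u
    rw [hA]
    have h1 : N'ᵀ *ᵥ (T ∘ (A *ᵥ u)) = 0 ↔ A *ᵥ u = 0 := by
      constructor
      · intro h0
        have h2 := congrArg (Nᵀ *ᵥ ·) h0
        simp only [mulVec_mulVec, hNN'', one_mulVec, mulVec_zero] at h2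
        refine comp_injective T (h2.trans ?_)
        ext1 i
        simp
      · intro h0
        rw [h0]
        have : T ∘ (0 : Fin 3 → S) = 0 := by ext1 i; simp
        rw [this, mulVec_zero]
    rw [h1, h.exact_B_A u]
    constructor
    · rintro ⟨t, rfl⟩
      exact ⟨T ∘ t, (comp_mulVec T B t).symm⟩
    · rintro ⟨t, ht⟩
      obtain ⟨t, rfl⟩ := exists_eq_comp T t
      rw [← comp_mulVec] at ht
      exact ⟨t, comp_injective T ht⟩
  · intro a
    obtain ⟨b, hb⟩ := exists_eq_comp T (Nᵀ *ᵥ a)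
    have ha : a = N'ᵀ *ᵥ (T ∘ b) := by rw [← hb, mulVec_mulVec, hNN', one_mulVec]
    change a ⬝ᵥ grad (C c * T f) = 0 ↔ _
    rw [hgrad, hb, ← hdot, mul_eq_zero, or_iff_right hC, map_eq_zero_iff T T.injective]
    refine (h.exact_A_grad b).trans ?_
    constructor
    · rintro ⟨u, rfl⟩
      exact ⟨T ∘ u, by rw [hA, ha]⟩
    · rintro ⟨u, hu⟩
      obtain ⟨u, rfl⟩ := exists_eq_comp T u
      refine ⟨u, comp_injective T ?_⟩
      rw [hA] at hu
      rw [← hb, ← hu, mulVec_mulVec, hNN'', one_mulVec]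
  · intro p
    rw [Ideal.Quotient.eq_zero_iff_mem, jacobianIdeal, Ideal.mem_span_range_iff_exists_fun]
    simp [dotProduct]

theorem isSyzygyCurve_lineSubst {f : S} {d k : ℕ} {δ : Fin (k + 2) → ℕ} (h : IsSyzygyCurve f d δ)
    {c : ℂ} (hc : c ≠ 0) : IsSyzygyCurve (C c * lineSubst g f) d δ := by
  obtain ⟨hf, hδ, hpos, e, A, B, he, hres⟩ := h
  exact ⟨isReducedCurve_lineSubst g hf hc, hδ, hpos, e, _, _, he,
    isMinimalResolution_lineSubst g hres hc⟩

end Substitution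

/-! ### The standard arrangement without x = 0 -/

theorem kleinNormal_eq_of_smul {i j : Fin 21} {c : ℂ} (h : c • kleinNormal i = kleinNormal j) :
    i = j := by
  by_contra hij
  apply intCross_ne_zero i j hij
  have h0 := congrFun h 0
  have h1 := congrFun h 1
  have h2 := congrFun h 2
  simp only [kleinNormal_eq, Pi.smul_apply, smul_eq_mul, Function.comp_apply] at h0 h1 h2
  ext1 k
  apply toComplex_injective
  fin_cases k <;> simp [intCross, ← h0, ← h1, ← h2] <;> ring

theorem eq_of_linearForm_kleinNormal_dvd (i j : Fin 21)
    (h : linearForm (kleinNormal i) ∣ linearForm (kleinNormal j)) : i = j := by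
  obtain ⟨c, hc⟩ := exists_smul_of_linearForm_dvd (kleinNormal_ne_zero i) h
  exact kleinNormal_eq_of_smul hc

theorem isSyzygyCurve_standard :
    IsSyzygyCurve (∏ i ∈ Finset.univ.erase 0, linearForm (kleinNormal i)) 20 (k := 1)
      ![9, 11, 12] := by
  have h0 : (X 0 : S) ∣ X 0 ^ 2 := dvd_pow_self _ two_ne_zero
  refine isSyzygyCurve_deletion kleinNormal kleinNormal_ne_zero eq_of_linearForm_kleinNormal_dvd
    (by simp [linearForm, kleinNormal, Fin.sum_univ_three])
    theta₁_isHomogeneous theta₂_isHomogeneous theta₁_tangent theta₂_tangent det_theta_ne_zero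
    -- By α² = α - 2 the last factor is (y² - α²z²)(α²y² - z²). Thus P cuts out the eight points
    -- where the other mirrors meet x = 0, at which a field tangent to all mirrors is proportional
    -- to E.
    (P := X 1 * X 2 * (X 1 ^ 2 - X 2 ^ 2) * ((C alpha - 2) * (X 1 ^ 4 + X 2 ^ 4) +
      (3 * C alpha - 3) * X 1 ^ 2 * X 2 ^ 2))
    (h₁ := X 1 ^ 2 + X 2 ^ 2) (h₂ := 2 * (X 1 ^ 2 * X 2 ^ 2)) ?_ ?_ ?_ ?_ ?_ ?_
    restrictions_coprime
  · exact (isHomogeneous_X_pow 1 2).add (isHomogeneous_X_pow 2 2)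
  · exact ((isHomogeneous_X_pow 1 2).mul (isHomogeneous_X_pow 2 2)).C_mul 2
  · rintro ⟨q, hq⟩
    have h := congrArg (eval (![0, 2, 1] : Fin 3 → ℂ)) hq
    simp at h
    have h2 : ((-276 : ℤ) : ℂ) + (174 : ℤ) * alpha = 0 := by
      push_cast
      rcases h with h | h
      · norm_num at h
      · linear_combination 6 * h
    exact absurd (int_add_int_mul_alpha_eq_zero h2).1 (by norm_num)
  · rintro ⟨q, hq⟩
    have h := congrArg (eval (![0, 1, 0] : Fin 3 → ℂ)) hq
    simp at h
  -- Modulo x the wedge with E is yz(p(y², 0, z²) - p(z², 0, y²)), p being the coefficient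
  -- polynomial, and this equals P h₁.
  · have h := dvd_sub (h0.trans (dvd_coeff₁_sub (C alpha) (X 1 ^ 2) (X 0 ^ 2) (X 2 ^ 2)))
      (h0.trans (dvd_coeff₁_sub (C alpha) (X 2 ^ 2) (X 0 ^ 2) (X 1 ^ 2)))
    refine (congrArg (fun q : S => X 0 ∣ q) ?_).mp (h.mul_left (X 1 * X 2))
    simp only [theta₁, oddField, coeff₁, cons_val]
    ring
  · have h := dvd_sub (h0.trans (dvd_coeff₂_sub (C alpha) (X 1 ^ 2) (X 0 ^ 2) (X 2 ^ 2)))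
      (h0.trans (dvd_coeff₂_sub (C alpha) (X 2 ^ 2) (X 0 ^ 2) (X 1 ^ 2)))
    refine (congrArg (fun q : S => X 0 ∣ q) ?_).mp (h.mul_left (X 1 * X 2))
    simp only [theta₂, oddField, coeff₂, cons_val]
    ring

/-! ### Transitivity of the symmetries on the mirrors -/

/-- The line with the normal vector `kleinNormal i`. -/
def kleinLine (i : Fin 21) : Line := Projectivization.mk ℂ (kleinNormal i) (kleinNormal_ne_zero i)

/-- The permutation of the Klein lines induced by `intMatrix₇`. -/
def perm₇ : Fin 21 → Fin 21 :=
  ![17, 18, 4, 15, 11, 14, 10, 3, 0, 1, 2, 19, 20, 9, 8, 13, 6, 12, 7, 16, 5]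

/-- The permutation of the Klein lines induced by `intMatrix₃`. -/
def perm₃ : Fin 21 → Fin 21 :=
  ![2, 0, 1, 7, 8, 3, 4, 5, 6, 13, 14, 16, 15, 17, 18, 20, 19, 9, 10, 11, 12]

/-- A multiple of an element of order 7 of the Klein group. -/
def intMatrix₇ : Matrix (Fin 3) (Fin 3) KleinInt :=
  !![⟨0, 1⟩, ⟨0, -1⟩, 0; 1, 1, ⟨1, -1⟩; 1, 1, ⟨-1, 1⟩]

/-- An element of order 3 of the Klein group. -/
def intMatrix₃ : Matrix (Fin 3) (Fin 3) KleinInt :=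
  !![0, 1, 0; 0, 0, 1; 1, 0, 0]

theorem intCross_intMatrix₇ :
    ∀ j, intCross (intNormal (perm₇ j)) (intMatrix₇ *ᵥ intNormal j) = 0 := by
  decide +kernel

theorem intCross_intMatrix₃ :
    ∀ j, intCross (intNormal (perm₃ j)) (intMatrix₃ *ᵥ intNormal j) = 0 := by
  decide +kernel

theorem exists_iterate_perm : ∀ i, ∃ a : Fin 7, ∃ b : Fin 3, perm₇^[a] (perm₃^[b] 0) = i := by
  decide +kernel

theorem exists_smul_eq_of_cross {v w : Fin 3 → ℂ} (hv : v ≠ 0) (h0 : v 1 * w 2 = v 2 * w 1)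
    (h1 : v 2 * w 0 = v 0 * w 2) (h2 : v 0 * w 1 = v 1 * w 0) : ∃ c : ℂ, w = c • v := by
  obtain ⟨i, hi⟩ := Function.ne_iff.1 hv
  refine ⟨w i / v i, ?_⟩
  have hi' : v i ≠ 0 := hi
  ext j
  rw [Pi.smul_apply, smul_eq_mul, div_mul_eq_mul_div, eq_div_iff hi']
  fin_cases i <;> fin_cases j <;> simp only [Fin.zero_eta, Fin.mk_one,
    Fin.reduceFinMk]
  · linear_combination h2
  · linear_combination -h1
  · linear_combination -h2
  · linear_combination h0
  · linear_combination h1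
  · linear_combination -h0

/-- `g` permutes the Klein lines by `σ`. -/
def Permutes (g : (Fin 3 → ℂ) ≃ₗ[ℂ] (Fin 3 → ℂ)) (σ : Fin 21 → Fin 21) : Prop :=
  ∀ j, ∃ c : ℂ, g (kleinNormal j) = c • kleinNormal (σ j)

theorem exists_permutes_of_intMatrix (N : Matrix (Fin 3) (Fin 3) KleinInt) (σ : Fin 21 → Fin 21)
    (hN : N.det ≠ 0) (h : ∀ j, intCross (intNormal (σ j)) (N *ᵥ intNormal j) = 0) :
    ∃ g, Permutes g σ := by
  have hdet : (N.map toComplex).det ≠ 0 := by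
    have := toComplex.map_det N
    rw [RingHom.mapMatrix_apply] at this
    rw [← this]
    exact (map_ne_zero_iff _ toComplex_injective).2 hN
  have hinj : Function.Injective (Matrix.mulVecLin (N.map toComplex)) :=
    Matrix.mulVec_injective_of_isUnit ((isUnit_iff_isUnit_det _).2 (isUnit_iff_ne_zero.2 hdet))
  refine ⟨LinearEquiv.ofInjectiveEndo _ hinj, fun j => ?_⟩
  have he : LinearEquiv.ofInjectiveEndo _ hinj (kleinNormal j) =
      toComplex ∘ (N *ᵥ intNormal j) := by
    rw [kleinNormal_eq]
    ext1 i
    exact (RingHom.map_mulVec toComplex N (intNormal j) i).symm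
  rw [he]
  have hj := h j
  have hk : ∀ k, toComplex (intCross (intNormal (σ j)) (N *ᵥ intNormal j) k) = 0 := by
    intro k
    rw [hj]
    exact map_zero _
  have h0 := hk 0
  have h1 := hk 1
  have h2 := hk 2
  simp only [intCross, cons_val, map_sub, map_mul] at h0 h1 h2
  refine exists_smul_eq_of_cross (kleinNormal_ne_zero _) ?_ ?_ ?_ <;> rw [kleinNormal_eq] <;>
    simp only [Function.comp_apply]
  · exact sub_eq_zero.1 h0
  · exact sub_eq_zero.1 h1
  · exact sub_eq_zero.1 h2

theorem Permutes.trans {g g' : (Fin 3 → ℂ) ≃ₗ[ℂ] (Fin 3 → ℂ)} {σ σ' : Fin 21 → Fin 21}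
    (h : Permutes g σ) (h' : Permutes g' σ') : Permutes (g.trans g') (σ' ∘ σ) := by
  intro j
  obtain ⟨c, hc⟩ := h j
  obtain ⟨c', hc'⟩ := h' (σ j)
  refine ⟨c * c', ?_⟩
  rw [LinearEquiv.trans_apply, hc, map_smul, hc', smul_smul, Function.comp_apply]

theorem Permutes.injective {g : (Fin 3 → ℂ) ≃ₗ[ℂ] (Fin 3 → ℂ)} {σ : Fin 21 → Fin 21}
    (h : Permutes g σ) : Function.Injective σ := by
  intro i j hij
  obtain ⟨c, hc⟩ := h i
  obtain ⟨c', hc'⟩ := h j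
  rw [← hij] at hc'
  have hc0 : c ≠ 0 := by
    rintro rfl
    rw [zero_smul, map_eq_zero_iff _ g.injective] at hc
    exact kleinNormal_ne_zero i hc
  refine kleinNormal_eq_of_smul (c := c' / c) (g.injective ?_)
  rw [map_smul, hc, hc', smul_smul, div_mul_cancel₀ _ hc0]

/-- Powers of the order 3 element carry mirror 0 to the three coordinate lines, and powers of the
order 7 element spread these over all 21. -/
theorem exists_permutes (i : Fin 21) : ∃ g σ, Permutes g σ ∧ σ 0 = i := by
  obtain ⟨g₇, h₇⟩ := exists_permutes_of_intMatrix intMatrix₇ perm₇ (by decide +kernel)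
    intCross_intMatrix₇
  obtain ⟨g₃, h₃⟩ := exists_permutes_of_intMatrix intMatrix₃ perm₃ (by decide +kernel)
    intCross_intMatrix₃
  have iter : ∀ (τ : Fin 21 → Fin 21), (∃ g, Permutes g τ) → ∀ (n : ℕ) (k : Fin 21),
      (∃ g σ, Permutes g σ ∧ σ 0 = k) → ∃ g σ, Permutes g σ ∧ σ 0 = τ^[n] k := by
    rintro τ ⟨g', hg'⟩ n
    induction n with
    | zero => exact fun k hk => hk
    | succ n ih =>
      rintro k ⟨g, σ, hg, hσ⟩
      exact ih (τ k) ⟨_, _, hg.trans hg', congrArg τ hσ⟩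
  obtain ⟨a, b, hab⟩ := exists_iterate_perm i
  rw [← hab]
  exact iter _ ⟨g₇, h₇⟩ a _ (iter _ ⟨g₃, h₃⟩ b 0
    ⟨LinearEquiv.refl ℂ _, id, fun j => ⟨1, (one_smul ℂ _).symm⟩, rfl⟩)

theorem map_kleinLine {g h : (Fin 3 → ℂ) ≃ₗ[ℂ] (Fin 3 → ℂ)} {σ : Fin 21 → Fin 21}
    (hσ : Permutes h σ) (j : Fin 21) :
    Projectivization.map g.toLinearMap g.injective (kleinLine (σ j)) =
      Projectivization.map (h.trans g).toLinearMap (h.trans g).injective (kleinLine j) := by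
  obtain ⟨c, hc⟩ := hσ j
  rw [kleinLine, kleinLine, Projectivization.map_mk, Projectivization.map_mk, eq_comm,
    Projectivization.mk_eq_mk_iff']
  refine ⟨c, ?_⟩
  simp [hc]

theorem kleinLine_injective : Function.Injective kleinLine := by
  intro i j hij
  rw [kleinLine, kleinLine, Projectivization.mk_eq_mk_iff'] at hij
  obtain ⟨c, hc⟩ := hij
  exact (kleinNormal_eq_of_smul hc).symm

end KleinDeletion

end

open MvPolynomial PlaneCurve LineArrangement KleinDeletion in
theorem proposition5p1 (K : Finset LineArrangement.Line) (hK : LineArrangement.IsKlein K)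
    (ℓ : LineArrangement.Line) (hℓ : ℓ ∈ K) :
    PlaneCurve.IsMinimalPlusOneGenerated
      (LineArrangement.definingPolynomial (LineArrangement.deletion K ℓ)) 9 11 12 := by
  classical
  obtain ⟨g, rfl⟩ := hK
  have hmem : ∃ i, Projectivization.map g.toLinearMap g.injective (kleinLine i) = ℓ := by
    obtain ⟨m, hm, rfl⟩ := Finset.mem_image.1 hℓ
    obtain ⟨i, -, rfl⟩ := Finset.mem_image.1 hm
    exact ⟨i, rfl⟩
  obtain ⟨i, rfl⟩ := hmem
  -- Composing g with a symmetry h leaves the arrangement unchanged and makes the deleted line the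
  -- image of x = 0.
  obtain ⟨h, σ, hσ, rfl⟩ := exists_permutes i
  set G := h.trans g
  let L : Fin 21 → Line := fun j => Projectivization.map G.toLinearMap G.injective (kleinLine j)
  have hL : Function.Injective L :=
    (Projectivization.map_injective _ G.injective).comp kleinLine_injective
  have hdel : deletion (standardKlein.image (Projectivization.map g.toLinearMap g.injective))
      (Projectivization.map g.toLinearMap g.injective (kleinLine (σ 0))) =
      (Finset.univ.erase 0).image L := by
    rw [Finset.image_erase hL, map_kleinLine hσ, deletion]
    have himg : standardKlein.image (Projectivization.map g.toLinearMap g.injective) =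
        Finset.univ.image L := by
      ext m
      simp only [standardKlein, Finset.mem_image, Finset.mem_univ, true_and,
        exists_exists_eq_and]
      constructor
      · rintro ⟨j, rfl⟩
        obtain ⟨j, rfl⟩ := (Finite.injective_iff_surjective.1 hσ.injective) j
        exact ⟨j, (map_kleinLine hσ j).symm⟩
      · rintro ⟨j, rfl⟩
        exact ⟨σ j, map_kleinLine hσ j⟩
    rw [himg]
  -- The chosen representatives differ from the transformed normals by nonzero scalars, whose
  -- product is the constant allowed in `isSyzygyCurve_lineSubst`.
  have hrep : ∀ j, ∃ c : ℂ, c ≠ 0 ∧ (L j).rep = c • G (kleinNormal j) := by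
    intro j
    obtain ⟨c, hc⟩ := Projectivization.exists_smul_eq_mk_rep ℂ (G (kleinNormal j))
      ((map_ne_zero_iff _ G.injective).2 (kleinNormal_ne_zero j))
    exact ⟨c, c.ne_zero, hc.symm⟩
  choose c hc0 hc using hrep
  have hpoly : definingPolynomial ((Finset.univ.erase 0).image L) =
      C (∏ j ∈ Finset.univ.erase 0, c j) *
        lineSubst G (∏ j ∈ Finset.univ.erase 0, linearForm (kleinNormal j)) := by
    rw [definingPolynomial, Finset.prod_image hL.injOn, map_prod, map_prod,
      ← Finset.prod_mul_distrib]
    refine Finset.prod_congr rfl fun j _ => ?_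
    rw [hc, linearForm_smul, lineSubst_linearForm]
  rw [hdel, hpoly]
  exact ⟨⟨20, isSyzygyCurve_lineSubst G isSyzygyCurve_standard
    (Finset.prod_ne_zero_iff.2 fun j _ => hc0 j), rfl⟩, rfl⟩
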